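/- Theorem (Master Formula). Let $\mathcal E,\mathcal S$ be finite sets, $\bm\alpha$ a probability row vector on $\mathcal E$, $\bm T$ a subintensity matrix on $\mathcal E$, $\bm U\ge 0$ an $\mathcal E\times\mathcal S$ matrix with $\bm T\bm 1+\bm U\bm 1=\bm 0$, and $\bm Q_1,\bm Q_2$ subintensity matrices on $\mathcal S$. Here a subintensity matrix has nonnegative off-diagonal entries and nonpositive row sums, and all its states are transient, i.e. $e^{\bm Tt}\to\bm 0$ as $t\to\infty$ (and likewise for $\bm Q_1,\bm Q_2$). Put $\bm q_i=-\bm Q_i\bm 1$. Let $(J_{1,2},J_1,J_2)$ be the bivariate common-shock construction with these parameters. That is, $J_{1,2}$ is a right-continuous Markov jump process on $\mathcal E\cup\mathcal S$ with initial distribution $(\bm\alpha,\bm 0)$ and intensity matrix $\begin{pmatrix}\bm T&\bm U\\ \bm 0&\bm 0\end{pmatrix}$; $\tau_{1,2}=\inf\{t\ge 0: J_{1,2}(t)\notin\mathcal E\}$ and $K=J_{1,2}(\tau_{1,2})$. The processes $J_1,J_2$ on $\mathcal E\cup\mathcal S\cup\{\partial\}$ coincide with $J_{1,2}$ on $[0,\tau_{1,2}]$.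 For every $k\in\mathcal S$ with $\mathbb P(K=k)>0$, conditionally on $K=k$, the process $J_i(\tau_{1,2}+\cdot)$ is a right-continuous Markov jump process started in $k$, moving in $\mathcal S$ according to $\bm Q_i$ and absorbed in $\partial$ at rates $\bm q_i$ ($i=1,2$), and the processes $J_1(\tau_{1,2}+\cdot)$, $J_2(\tau_{1,2}+\cdot)$ and $J_{1,2}$ are independent. Let $\tilde\tau_i$ be the total time that $J_i$ spends in $\mathcal S$. For $N\in\mathbb N_0$, $\theta\in\mathbb R$ and a $p\times p$ matrix $\bm M$, let $\bm M^{(N,\theta)}$ be the $(N+1)\times(N+1)$ block matrix with $p\times p$ blocks that has $\bm M-\theta\bm I$ on the block diagonal, $\bm I$ on the first block superdiagonal, and zeros elsewhere. Let $\bm\alpha^{(N)}=(\bm\alpha,\bm 0,\dots,\bm 0)$ and $\bm q_i^{(N)}=(\bm 0,\dots,\bm 0,\bm q_i^\top)^\top$ have $N+1$ blocks, let $\bm I^{(\downarrow,N)}$ be the block column of $N+1$ blocks with $\bm I$ in the last block and zeros elsewhere, and let $\bm I^{(\leftarrow,N)}$ be the block row of $N+1$ blocks with $\bm I$ in the first block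 and zeros elsewhere. Let $\bm P=\sum_{k\in\mathcal S}\bm U\bm e_k(\bm e_k^\top\otimes\bm e_k^\top)$. Let $n_{1,2},n_1,n_2\in\mathbb N_0$, $\theta_{1,2},\theta_1,\theta_2\in\mathbb R$ and $y_{1,2},y_1,y_2\ge 0$. Assume that the expectation below converges (its integrand is integrable) and that $\bm T^{(n_{1,2},\theta_{1,2})}$, $\bm Q_1^{(n_1,\theta_1)}$ and $\bm Q_2^{(n_2,\theta_2)}$ are invertible. Then $$\begin{aligned} &\mathbb E\Bigl[\tau_{1,2}^{n_{1,2}}e^{-\theta_{1,2}\tau_{1,2}}\;\tilde\tau_1^{\,n_1}e^{-\theta_1\tilde\tau_1}\;\tilde\tau_2^{\,n_2}e^{-\theta_2\tilde\tau_2}\;\mathbf 1\{\tau_{1,2}>y_{1,2},\ \tilde\tau_1>y_1,\ \tilde\tau_2>y_2\}\Bigr]\\ &\quad=n_{1,2}!\,n_1!\,n_2!\;\;\bm\alpha^{(n_{1,2})}\,e^{\bm T^{(n_{1,2},\theta_{1,2})}y_{1,2}}\bigl(-\bm T^{(n_{1,2},\theta_{1,2})}\bigr)^{-1}\bm I^{(\downarrow,n_{1,2})}\,\bm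 P\\ &\qquad\times\Bigl[\Bigl(\bm I^{(\leftarrow,n_1)}e^{\bm Q_1^{(n_1,\theta_1)}y_1}\bigl(-\bm Q_1^{(n_1,\theta_1)}\bigr)^{-1}\bm q_1^{(n_1)}\Bigr)\otimes\Bigl(\bm I^{(\leftarrow,n_2)}e^{\bm Q_2^{(n_2,\theta_2)}y_2}\bigl(-\bm Q_2^{(n_2,\theta_2)}\bigr)^{-1}\bm q_2^{(n_2)}\Bigr)\Bigr]. \end{aligned}$$ -/

import Mathlib

open MeasureTheory ProbabilityTheory Filter
open scoped NNReal Matrix Topology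

namespace CommonShock

noncomputable section

/-! ### Markov jump processes -/

/-- `J` is a (right-continuous) time-homogeneous Markov jump process on the finite state space `X`
with initial distribution `init` and intensity matrix `G`: its finite-dimensional distributions are
`P(J(t₀) = x₀, …, J(tₙ) = xₙ) = init(x₀) ∏ᵢ (e^{(tᵢ₊₁ - tᵢ) G})(xᵢ, xᵢ₊₁)` for
`0 = t₀ ≤ t₁ ≤ ⋯ ≤ tₙ`. -/
structure IsMarkovJumpProcess {Ω X : Type*} [MeasurableSpace Ω] [Fintype X] [DecidableEq X]
    (init : X → ℝ) (G : Matrix X X ℝ) (P : Measure Ω) (J : ℝ≥0 → Ω → X) : Prop where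
  measurableSet_eq : ∀ (t : ℝ≥0) (x : X), MeasurableSet {ω | J t ω = x}
  rightContinuous : ∀ (ω : Ω) (t : ℝ≥0), ∃ δ : ℝ≥0, 0 < δ ∧
    ∀ s : ℝ≥0, t ≤ s → s < t + δ → J s ω = J t ω
  finiteDim : ∀ (n : ℕ) (t : Fin (n + 1) → ℝ≥0), Monotone t → t 0 = 0 →
    ∀ x : Fin (n + 1) → X,
      P.real {ω | ∀ i, J (t i) ω = x i} =
        init (x 0) * ∏ i : Fin n,
          NormedSpace.exp (((t i.succ : ℝ) - (t i.castSucc : ℝ)) • G) (x i.castSucc) (x i.succ)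

/-- The σ-algebra on `Ω` generated by the whole path of the process `J`. -/
@[reducible] def pathSigma {Ω X : Type*} (J : ℝ≥0 → Ω → X) : MeasurableSpace Ω :=
  ⨆ t : ℝ≥0, MeasurableSpace.comap (J t) ⊤

/-! ### Parameters -/

/-- `T` is a subintensity matrix all of whose states are transient: nonnegative off-diagonal
entries, nonpositive row sums (hence nonpositive diagonal entries), and, from every state, the
probability of not having left the state space by time `t` tends to `0`. -/
structure IsSubintensity {X : Type*} [Fintype X] [DecidableEq X] (T : Matrix X X ℝ) : Prop where
  offDiag_nonneg : ∀ i j, i ≠ j → 0 ≤ T i j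
  rowSum_nonpos : ∀ i, ∑ j, T i j ≤ 0
  transient : ∀ i j, Tendsto (fun t : ℝ => NormedSpace.exp (t • T) i j) atTop (𝓝 0)

/-- The vector of absorption rates `q = -Q 1`. -/
def exitRates {X : Type*} [Fintype X] (Q : Matrix X X ℝ) : X → ℝ :=
  -(Q *ᵥ (fun _ => 1))

/-- Validity of the parameters `(α, T, U, Q₁, Q₂)`; `E` is the set of pre-shock states and `S` the
set of post-shock states. -/
structure IsParam {E S : Type*} [Fintype E] [DecidableEq E] [Fintype S] [DecidableEq S]
    (α : E → ℝ) (T : Matrix E E ℝ) (U : Matrix E S ℝ) (Q₁ Q₂ : Matrix S S ℝ) : Prop where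
  init_nonneg : ∀ e, 0 ≤ α e
  init_sum : ∑ e, α e = 1
  subintensity_T : IsSubintensity T
  U_nonneg : ∀ e k, 0 ≤ U e k
  conservative : ∀ e, ∑ e', T e e' + ∑ k, U e k = 0
  subintensity_Q₁ : IsSubintensity Q₁
  subintensity_Q₂ : IsSubintensity Q₂

/-! ### The common-shock construction -/

/-- The common-shock time `τ₁₂ = inf {t ≥ 0 : J₁₂(t) ∉ E}`. -/
def shockTime {Ω E S : Type*} (J₁₂ : ℝ≥0 → Ω → E ⊕ S) (ω : Ω) : ℝ≥0 :=
  sInf {t : ℝ≥0 | J₁₂ t ω ∉ Set.range (Sum.inl : E → E ⊕ S)}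

/-- The state `K = J₁₂(τ₁₂)` entered at the common shock. -/
def shockState {Ω E S : Type*} (J₁₂ : ℝ≥0 → Ω → E ⊕ S) (ω : Ω) : E ⊕ S :=
  J₁₂ (shockTime J₁₂ ω) ω

/-- The process `t ↦ J(τ₁₂ + t)` restarted at the common shock. -/
def afterShock {Ω E S X : Type*} (J₁₂ : ℝ≥0 → Ω → E ⊕ S) (J : ℝ≥0 → Ω → X) (t : ℝ≥0) (ω : Ω) : X :=
  J (shockTime J₁₂ ω + t) ω

/-- The total time `τ̃` spent in `S` by a process `J` on `E ∪ S ∪ {∂}`. -/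
def residualTime {Ω E S : Type*} (J : ℝ≥0 → Ω → E ⊕ (S ⊕ Unit)) (ω : Ω) : ℝ :=
  (volume {t : ℝ | 0 ≤ t ∧
    J t.toNNReal ω ∈ Set.range (fun k : S => (Sum.inr (Sum.inl k) : E ⊕ (S ⊕ Unit)))}).toReal

/-- The intensity matrix of the joint process on `E ∪ S`: `(T U; 0 0)`. -/
def jointIntensity {E S : Type*} (T : Matrix E E ℝ) (U : Matrix E S ℝ) :
    Matrix (E ⊕ S) (E ⊕ S) ℝ :=
  Matrix.fromBlocks T U 0 0

/-- The intensity matrix on `E ∪ S ∪ {∂}` of a process which moves inside `S` according to the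
subintensity matrix `Q`, and is absorbed in `∂` at rates `q = -Q 1`. (The states of `E` are never
visited after the shock; their rows are zero.) -/
def residualIntensity {E S : Type*} [Fintype S] (Q : Matrix S S ℝ) :
    Matrix (E ⊕ (S ⊕ Unit)) (E ⊕ (S ⊕ Unit)) ℝ :=
  Matrix.fromBlocks 0 0 0
    (Matrix.fromBlocks Q (Matrix.replicateCol Unit (exitRates Q)) 0 0)

/-- The bivariate common-shock construction with parameters `(α, T, U, Q₁, Q₂)`.

* `J₁₂` starts in `E` from `α`, moves inside `E` by `T`, enters `S` by `U`, and then stays put.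
* `J₁` and `J₂` coincide with `J₁₂` up to and including the shock time `τ₁₂`.
* Given that `K = k` is the state entered at the shock, the restarted processes `J₁(τ₁₂ + ·)` and
  `J₂(τ₁₂ + ·)` are Markov jump processes started in `k` and governed by `Q₁` and `Q₂` until their
  absorption in `∂`, and they are independent of each other and of `J₁₂`. -/
structure IsCommonShock {Ω E S : Type*} [MeasurableSpace Ω]
    [Fintype E] [DecidableEq E] [Fintype S] [DecidableEq S]
    (α : E → ℝ) (T : Matrix E E ℝ) (U : Matrix E S ℝ) (Q₁ Q₂ : Matrix S S ℝ)
    (P : Measure Ω) (J₁₂ : ℝ≥0 → Ω → E ⊕ S) (J₁ J₂ : ℝ≥0 → Ω → E ⊕ (S ⊕ Unit)) : Prop where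
  param : IsParam α T U Q₁ Q₂
  joint : IsMarkovJumpProcess (Sum.elim α 0) (jointIntensity T U) P J₁₂
  coincide₁ : ∀ ω t, t ≤ shockTime J₁₂ ω → J₁ t ω = Sum.map id Sum.inl (J₁₂ t ω)
  coincide₂ : ∀ ω t, t ≤ shockTime J₁₂ ω → J₂ t ω = Sum.map id Sum.inl (J₁₂ t ω)
  residual₁ : ∀ k : S, P {ω | shockState J₁₂ ω = Sum.inr k} ≠ 0 →
    IsMarkovJumpProcess (Pi.single (Sum.inr (Sum.inl k)) 1) (residualIntensity Q₁)
      (P[|{ω | shockState J₁₂ ω = Sum.inr k}]) (afterShock J₁₂ J₁)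
  residual₂ : ∀ k : S, P {ω | shockState J₁₂ ω = Sum.inr k} ≠ 0 →
    IsMarkovJumpProcess (Pi.single (Sum.inr (Sum.inl k)) 1) (residualIntensity Q₂)
      (P[|{ω | shockState J₁₂ ω = Sum.inr k}]) (afterShock J₁₂ J₂)
  indep : ∀ k : S, P {ω | shockState J₁₂ ω = Sum.inr k} ≠ 0 →
    iIndep ![pathSigma J₁₂, pathSigma (afterShock J₁₂ J₁), pathSigma (afterShock J₁₂ J₂)]
      (P[|{ω | shockState J₁₂ ω = Sum.inr k}])

/-! ### Kronecker products and augmented matrices -/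

/-- The Kronecker product `v ⊗ w` of two vectors. -/
def kron {X Y : Type*} (v : X → ℝ) (w : Y → ℝ) : X × Y → ℝ :=
  fun z => v z.1 * w z.2

/-- `P = ∑ₖ u⁽ᵏ⁾ (eₖᵀ ⊗ eₖᵀ)`, where `u⁽ᵏ⁾ = U eₖ` is the `k`-th column of `U`. -/
def shockMatrix {E S : Type*} [Fintype S] [DecidableEq S] (U : Matrix E S ℝ) :
    Matrix E (S × S) ℝ :=
  ∑ k : S, Matrix.vecMulVec (U *ᵥ Pi.single k 1) (kron (Pi.single k 1) (Pi.single k 1))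

/-- `M⁽ᴺ,ᶿ⁾`: the `(N+1) × (N+1)` block matrix with `M - θ I` on the block diagonal, `I` on the first
block superdiagonal, and zeros elsewhere. -/
def augMatrix {X : Type*} [DecidableEq X] (N : ℕ) (θ : ℝ) (M : Matrix X X ℝ) :
    Matrix (Fin (N + 1) × X) (Fin (N + 1) × X) ℝ :=
  Matrix.of fun a b =>
    if a.1 = b.1 then (M - θ • (1 : Matrix X X ℝ)) a.2 b.2
    else if (a.1 : ℕ) + 1 = (b.1 : ℕ) then (1 : Matrix X X ℝ) a.2 b.2
    else 0

/-- The augmented initial vector `α⁽ᴺ⁾ = (α, 0, …, 0)`. -/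
def augInit {X : Type*} (N : ℕ) (α : X → ℝ) : Fin (N + 1) × X → ℝ :=
  fun a => if a.1 = 0 then α a.2 else 0

/-- The augmented exit vector `q⁽ᴺ⁾ = (0, …, 0, q)ᵀ`. -/
def augExit {X : Type*} (N : ℕ) (q : X → ℝ) : Fin (N + 1) × X → ℝ :=
  fun a => if a.1 = Fin.last N then q a.2 else 0

/-- The selector `I⁽↓,ᴺ⁾`: a block column with `I` in the last block and zeros elsewhere. -/
def selDown (X : Type*) [DecidableEq X] (N : ℕ) : Matrix (Fin (N + 1) × X) X ℝ :=
  Matrix.of fun a x => if a.1 = Fin.last N then (1 : Matrix X X ℝ) a.2 x else 0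

/-- The selector `I⁽←,ᴺ⁾`: a block row with `I` in the first block and zeros elsewhere. -/
def selLeft (X : Type*) [DecidableEq X] (N : ℕ) : Matrix X (Fin (N + 1) × X) ℝ :=
  Matrix.of fun x a => if a.1 = 0 then (1 : Matrix X X ℝ) x a.2 else 0

/-- The integrand of the tilted, truncated mixed moment, for times `t₁₂, t₁, t₂`:
`t₁₂^{n₁₂} e^{-θ₁₂ t₁₂} t₁^{n₁} e^{-θ₁ t₁} t₂^{n₂} e^{-θ₂ t₂} 1{t₁₂ > y₁₂, t₁ > y₁, t₂ > y₂}`. -/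
def tiltedTruncated (n₁₂ n₁ n₂ : ℕ) (θ₁₂ θ₁ θ₂ y₁₂ y₁ y₂ : ℝ) (t₁₂ t₁ t₂ : ℝ) : ℝ :=
  open Classical in
  (t₁₂ ^ n₁₂ * Real.exp (-θ₁₂ * t₁₂)) * (t₁ ^ n₁ * Real.exp (-θ₁ * t₁)) *
    (t₂ ^ n₂ * Real.exp (-θ₂ * t₂)) * (if y₁₂ < t₁₂ ∧ y₁ < t₁ ∧ y₂ < t₂ then 1 else 0)

end

end CommonShock

/-! On the event `K = k` the shock time has subdensity `α e^{Tt} U e_k`; given this event, the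
residual times are independent of it and of each other, with densities `e_k e^{Q_i t} q_i`. The
moment is therefore a sum over `k` of products of three integrals of the form `∫_y^∞ tⁿ e^{-θt} β
e^{Qt} v dt`. The matrix `P` encodes this sum, because both restarted processes begin in the same
state `k`.

The subdensities come from absorption. A path frozen after leaving a set of states satisfies `{exit
≤ y, exit state = x} = {A y = x}` almost surely, so the joint law of exit time and exit state is a
one-dimensional marginal, differentiated by the forward equation (`map_exitTime`).

For the integrals, let `A` be the augmented matrix. The blocks of `W t = β⁽ⁿ⁾ e^{tA}` are `t^m/m!
e^{-θt} β e^{Qt}`, and `W' = W A`. If `W` is integrable, it vanishes at infinity, and `∫_y^∞ W = W y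
(-A)⁻¹`; `n!` times its last block gives the integral (`integral_tail_eq`).

The delicate point is integrability: only the full expectation is assumed finite. All sums and
products are thus taken in `ENNReal`. The residual integrals are never zero, so finiteness of each
product bounds the shock integral, and a nonzero shock integral bounds the residual ones.
Integrability against the exit rates then controls every entry of `W`, since every transient state
can reach the exit (`integrableOn_augInit_vecMul_exp`). -/

namespace CommonShock

/-! ### Matrix exponentials -/

section MatrixExp

variable {X Y : Type*} [Fintype X] [DecidableEq X] [Fintype Y] [DecidableEq Y]

open scoped Matrix.Norms.Operator in
theorem hasDerivAt_exp_smul_apply (M : Matrix X X ℝ) (t : ℝ) (i j : X) :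
    HasDerivAt (fun s : ℝ => NormedSpace.exp (s • M) i j) ((NormedSpace.exp (t • M) * M) i j) t :=
  hasDerivAt_pi.1 (hasDerivAt_pi.1 (hasDerivAt_exp_smul_const (𝕂 := ℝ) M t) i) j

theorem exp_add_smul (M : Matrix X X ℝ) (s t : ℝ) :
    NormedSpace.exp ((s + t) • M) = NormedSpace.exp (s • M) * NormedSpace.exp (t • M) := by
  rw [add_smul]
  exact Matrix.exp_add_of_commute _ _ ((Commute.refl M).smul_left s |>.smul_right t)

theorem exp_smul_mul_exp_neg_smul (M : Matrix X X ℝ) (t : ℝ) :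
    NormedSpace.exp (t • M) * NormedSpace.exp ((-t) • M) = 1 := by
  rw [← exp_add_smul]; simp

theorem commute_exp_smul (M : Matrix X X ℝ) (t : ℝ) :
    NormedSpace.exp (t • M) * M = M * NormedSpace.exp (t • M) := by
  open scoped Matrix.Norms.Operator in
  exact (((Commute.refl M).smul_left t).exp_left).eq

theorem hasDerivAt_vecMul_exp (v : X → ℝ) (M : Matrix X X ℝ) (t : ℝ) (j : X) :
    HasDerivAt (fun s : ℝ => (v ᵥ* NormedSpace.exp (s • M)) j)
      (((v ᵥ* NormedSpace.exp (t • M)) ᵥ* M) j) t := by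
  rw [Matrix.vecMul_vecMul]
  simp only [Matrix.vecMul, dotProduct]
  exact HasDerivAt.fun_sum fun i _ => (hasDerivAt_exp_smul_apply M t i j).const_mul _

/-- Uniqueness for the linear equation `w' = w A`: the row vector `w s e^{-sA}` has zero derivative.
Exponentials below are identified by exhibiting a solution with the right initial value. -/
theorem eq_vecMul_exp_of_hasDerivAt {w : ℝ → X → ℝ} {A : Matrix X X ℝ}
    (hw : ∀ t j, HasDerivAt (fun s => w s j) ((w t ᵥ* A) j) t) (t : ℝ) :
    w t = w 0 ᵥ* NormedSpace.exp (t • A) := by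
  have key : ∀ j, ∀ s, HasDerivAt (fun s => (w s ᵥ* NormedSpace.exp ((-s) • A)) j) 0 s := by
    intro j s
    have h : HasDerivAt (fun s => (w s ᵥ* NormedSpace.exp ((-s) • A)) j)
        (∑ i, ((w s ᵥ* A) i * NormedSpace.exp ((-s) • A) i j +
          w s i * ((NormedSpace.exp ((-s) • A) * A) i j * (-1)))) s := by
      simp only [Matrix.vecMul, dotProduct]
      refine HasDerivAt.fun_sum fun i _ => (hw s i).mul ?_
      exact (hasDerivAt_exp_smul_apply A (-s) i j).comp s (hasDerivAt_neg s)
    convert h using 1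
    have h1 : ∑ i, (w s ᵥ* A) i * NormedSpace.exp ((-s) • A) i j =
        ((w s ᵥ* A) ᵥ* NormedSpace.exp ((-s) • A)) j := rfl
    have h2 : ∑ i, w s i * ((NormedSpace.exp ((-s) • A) * A) i j * (-1)) =
        -((w s ᵥ* (NormedSpace.exp ((-s) • A) * A)) j) := by
      simp [Matrix.vecMul, dotProduct]
    rw [Finset.sum_add_distrib, h1, h2, Matrix.vecMul_vecMul, commute_exp_smul, add_neg_cancel]
  have hc : w t ᵥ* NormedSpace.exp ((-t) • A) = w 0 := by
    ext j
    have := is_const_of_deriv_eq_zero (fun s => (key j s).differentiableAt)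
      (fun s => (key j s).deriv) t 0
    simpa using this
  have hinv := exp_smul_mul_exp_neg_smul A (-t)
  rw [neg_neg] at hinv
  rw [← hc, Matrix.vecMul_vecMul, hinv, Matrix.vecMul_one]

theorem exp_apply_nonneg {B : Matrix X X ℝ} (hB : ∀ i j, 0 ≤ B i j) (i j : X) :
    0 ≤ NormedSpace.exp B i j := by
  open scoped Matrix.Norms.Operator in
  have h := NormedSpace.exp_series_hasSum_exp' (𝕂 := ℝ) B
  have h' := Pi.hasSum.1 (Pi.hasSum.1 h i) j
  refine h'.nonneg fun n => ?_
  have hp : ∀ n : ℕ, ∀ i j, 0 ≤ (B ^ n) i j := by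
    intro n
    induction n with
    | zero => intro i j; rw [pow_zero, Matrix.one_apply]; split_ifs <;> norm_num
    | succ n ih =>
      intro i j
      rw [pow_succ, Matrix.mul_apply]
      exact Finset.sum_nonneg fun k _ => mul_nonneg (ih i k) (hB k j)
  simp only [Matrix.smul_apply, smul_eq_mul]
  exact mul_nonneg (by positivity) (hp n i j)

/-- Adding `c I` makes all entries of `M` nonnegative, so its exponential series is nonnegative. The
scalar matrix commutes with everything and contributes only the positive factor `e^{-tc}`. -/
theorem exp_smul_apply_nonneg {M : Matrix X X ℝ} (hM : ∀ i j, i ≠ j → 0 ≤ M i j) {t : ℝ}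
    (ht : 0 ≤ t) (i j : X) : 0 ≤ NormedSpace.exp (t • M) i j := by
  set c : ℝ := ∑ k, |M k k| with hc
  have hshift : ∀ i j, 0 ≤ (t • (M + c • (1 : Matrix X X ℝ))) i j := by
    intro i j
    simp only [Matrix.smul_apply, Matrix.add_apply, smul_eq_mul, Matrix.one_apply]
    refine mul_nonneg ht ?_
    split_ifs with h
    · subst h
      have : |M i i| ≤ c :=
        Finset.single_le_sum (f := fun k => |M k k|) (fun k _ => abs_nonneg _) (Finset.mem_univ i)
      have := neg_abs_le (M i i)
      linarith
    · simpa using hM i j h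
  have hsplit : t • M = t • (M + c • (1 : Matrix X X ℝ)) + Matrix.diagonal (fun _ => -(t * c)) := by
    ext i j
    simp only [Matrix.smul_apply, Matrix.add_apply, smul_eq_mul, Matrix.one_apply,
      Matrix.diagonal_apply]
    split_ifs <;> ring
  rw [hsplit, Matrix.exp_add_of_commute, Matrix.exp_diagonal, Matrix.mul_diagonal]
  · refine mul_nonneg (exp_apply_nonneg hshift i j) ?_
    rw [Pi.coe_exp, ← Real.exp_eq_exp_ℝ]
    exact (Real.exp_pos _).le
  · have : Matrix.diagonal (fun _ : X => -(t * c)) = Matrix.scalar X (-(t * c)) := rfl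
    rw [this]
    exact (Matrix.scalar_commute _ (fun r => Commute.all _ r) _).symm

/-- If the rows of `G` vanish outside the range of `f`, then on the range of `f` the exponential of
`G` is the exponential of the corresponding submatrix. -/
theorem exp_smul_submatrix {f : Y → X} (hf : Function.Injective f) {G : Matrix X X ℝ}
    (hG : ∀ x, x ∉ Set.range f → ∀ z, G x z = 0) (t : ℝ) (i j : Y) :
    NormedSpace.exp (t • G) (f i) (f j) = NormedSpace.exp (t • G.submatrix f f) i j := by
  -- In the forward equation, states outside the range contribute nothing because their rows vanish,
  -- so the restricted row solves a closed linear equation.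
  have h := eq_vecMul_exp_of_hasDerivAt
    (w := fun t j => NormedSpace.exp (t • G) (f i) (f j)) (A := G.submatrix f f) ?_ t
  · refine (congrFun h j).trans ?_
    have : (fun j => NormedSpace.exp ((0 : ℝ) • G) (f i) (f j)) = Pi.single i 1 := by
      ext j
      rw [zero_smul, NormedSpace.exp_zero, Matrix.one_apply, Pi.single_apply]
      simp [hf.eq_iff, eq_comm]
    simp only [this, Matrix.single_one_vecMul]
    rfl
  · intro t j
    convert hasDerivAt_exp_smul_apply G t (f i) (f j) using 1
    simp only [Matrix.vecMul, dotProduct, Matrix.mul_apply, Matrix.submatrix_apply]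
    exact Finset.sum_of_injOn f hf.injOn (by simp)
      (fun x _ hx => by rw [hG x (by simpa using hx), mul_zero]) (fun _ _ => rfl)

end MatrixExp

/-! ### Tail integrals of augmented exponentials -/

section TailIntegral

variable {X : Type*} [Fintype X] [DecidableEq X]

theorem sum_vecMul_augMatrix (N : ℕ) (θ : ℝ) (M : Matrix X X ℝ) (w : Fin (N + 1) × X → ℝ)
    (m : Fin (N + 1)) (x : X) :
    (w ᵥ* augMatrix N θ M) (m, x) =
      ((fun z => w (m, z)) ᵥ* M) x - θ * w (m, x) +
        ∑ l : Fin (N + 1), if (l : ℕ) + 1 = m then w (l, x) else 0 := by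
  have h : ∀ l : Fin (N + 1), ∑ z, w (l, z) * augMatrix N θ M (l, z) (m, x) =
      (if l = m then ((fun z => w (m, z)) ᵥ* M) x - θ * w (m, x) else 0) +
        if (l : ℕ) + 1 = m then w (l, x) else 0 := by
    intro l
    by_cases h1 : l = m
    · subst h1
      have : ¬ ((l : ℕ) + 1 = l) := by omega
      simp only [augMatrix, Matrix.of_apply, if_true, this, if_false, add_zero, Matrix.sub_apply,
        Matrix.smul_apply, smul_eq_mul, Matrix.one_apply, mul_sub, Finset.sum_sub_distrib,
        Matrix.vecMul, dotProduct, mul_ite, mul_one, mul_zero, Finset.sum_ite_eq',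
        Finset.mem_univ]
      ring
    · by_cases h2 : (l : ℕ) + 1 = m <;>
      simp [augMatrix, h1, h2, Matrix.one_apply]
  simp only [Matrix.vecMul, dotProduct, Fintype.sum_prod_type] at h ⊢
  simp only [h, Finset.sum_add_distrib, Finset.sum_ite_eq', Finset.mem_univ, if_true]

/-- The first block row of the exponential of an augmented matrix. -/
theorem augInit_vecMul_exp_augMatrix (N : ℕ) (θ : ℝ) (M : Matrix X X ℝ) (β : X → ℝ) (t : ℝ)
    (m : Fin (N + 1)) (x : X) :
    (augInit N β ᵥ* NormedSpace.exp (t • augMatrix N θ M)) (m, x) =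
      t ^ (m : ℕ) / (m : ℕ).factorial * Real.exp (-θ * t) *
        (β ᵥ* NormedSpace.exp (t • M)) x := by
  have h := eq_vecMul_exp_of_hasDerivAt (A := augMatrix N θ M)
    (w := fun t (a : Fin (N + 1) × X) => t ^ (a.1 : ℕ) / (a.1 : ℕ).factorial * Real.exp (-θ * t) *
        (β ᵥ* NormedSpace.exp (t • M)) a.2) ?_ t
  · refine (Eq.trans (congrFun h (m, x)) ?_).symm
    congr 2
    ext ⟨l, z⟩
    by_cases hl : l = 0
    · subst hl; simp [augInit]
    · have : (l : ℕ) ≠ 0 := fun h => hl (Fin.ext h)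
      simp [augInit, hl, this]
  · rintro t ⟨m, x⟩
    have hd := ((((hasDerivAt_pow (m : ℕ) t).div_const ((m : ℕ).factorial : ℝ)).mul
      (((hasDerivAt_id t).const_mul (-θ)).exp)).mul (hasDerivAt_vecMul_exp β M t x))
    refine hd.congr_deriv ?_
    rw [sum_vecMul_augMatrix]
    have h1 : ((fun z => t ^ (m : ℕ) / (m : ℕ).factorial * Real.exp (-θ * t) *
        (β ᵥ* NormedSpace.exp (t • M)) z) ᵥ* M) x =
        t ^ (m : ℕ) / (m : ℕ).factorial * Real.exp (-θ * t) *
          ((β ᵥ* NormedSpace.exp (t • M)) ᵥ* M) x := by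
      rw [← smul_eq_mul _ (((β ᵥ* NormedSpace.exp (t • M)) ᵥ* M) x), ← Pi.smul_apply,
        ← Matrix.smul_vecMul]
      rfl
    -- The superdiagonal identity block reproduces the derivative of `t^m/m!`. For `m = 0` there is
    -- no preceding block, and the truncated exponent `m - 1` is harmless because of the factor `m`.
    have h2 : (∑ l : Fin (N + 1), if (l : ℕ) + 1 = m then
          t ^ (l : ℕ) / (l : ℕ).factorial * Real.exp (-θ * t) *
            (β ᵥ* NormedSpace.exp (t • M)) x else 0) =
        ((m : ℕ) : ℝ) * t ^ ((m : ℕ) - 1) / (m : ℕ).factorial * Real.exp (-θ * t) *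
          (β ᵥ* NormedSpace.exp (t • M)) x := by
      rcases Nat.eq_zero_or_pos (m : ℕ) with hm | hm
      · simp [hm]
      · rw [Finset.sum_eq_single (⟨(m : ℕ) - 1, by omega⟩ : Fin (N + 1))]
        · obtain ⟨k, hk⟩ : ∃ k, (m : ℕ) = k + 1 := ⟨(m : ℕ) - 1, by omega⟩
          simp only [hk, Nat.add_sub_cancel, if_true, Nat.factorial_succ]
          have : (k.factorial : ℝ) ≠ 0 := by positivity
          push_cast
          field_simp
        · intro b _ hb
          rw [if_neg]
          intro h
          exact hb (Fin.ext (by simp only; omega))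
        · simp
    simp only [h1, h2, id]
    simp only [Pi.mul_apply]
    ring

/-- The survival probability decreases at the rate of the exit density, since `Q 1 = -q`. -/
theorem IsSubintensity.sum_exp_hasDerivAt (Q : Matrix X X ℝ) (j : X) (t : ℝ) :
    HasDerivAt (fun s : ℝ => ∑ l, NormedSpace.exp (s • Q) j l)
      (-((NormedSpace.exp (t • Q) *ᵥ exitRates Q) j)) t := by
  refine (HasDerivAt.fun_sum fun l _ => hasDerivAt_exp_smul_apply Q t j l).congr_deriv ?_
  rw [exitRates, Matrix.mulVec_neg, Pi.neg_apply, neg_neg, Matrix.mulVec_mulVec]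
  simp [Matrix.mulVec, dotProduct]

theorem exitRates_nonneg {Q : Matrix X X ℝ} (hQ : IsSubintensity Q) (x : X) :
    0 ≤ exitRates Q x := by
  have := hQ.rowSum_nonpos x
  simp only [exitRates, Pi.neg_apply, Matrix.mulVec, dotProduct, mul_one]
  linarith

theorem exp_smul_mulVec_nonneg {Q : Matrix X X ℝ} (hQ : IsSubintensity Q) {v : X → ℝ}
    (hv : ∀ x, 0 ≤ v x) {t : ℝ} (ht : 0 ≤ t) (x : X) : 0 ≤ (NormedSpace.exp (t • Q) *ᵥ v) x :=
  Finset.sum_nonneg fun y _ => mul_nonneg (exp_smul_apply_nonneg hQ.offDiag_nonneg ht x y) (hv y)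

theorem vecMul_exp_smul_nonneg {Q : Matrix X X ℝ} (hQ : IsSubintensity Q) {v : X → ℝ}
    (hv : ∀ x, 0 ≤ v x) {t : ℝ} (ht : 0 ≤ t) (x : X) : 0 ≤ (v ᵥ* NormedSpace.exp (t • Q)) x :=
  Finset.sum_nonneg fun y _ => mul_nonneg (hv y) (exp_smul_apply_nonneg hQ.offDiag_nonneg ht y x)

/-- If the exit density from `j` vanished at all times, the survival probability would stay at 1,
contradicting transience. -/
theorem IsSubintensity.exists_exit_pos {Q : Matrix X X ℝ} (hQ : IsSubintensity Q) (j : X) :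
    ∃ s : ℝ, 0 ≤ s ∧ 0 < (NormedSpace.exp (s • Q) *ᵥ exitRates Q) j := by
  by_contra! hcon
  have hzero : ∀ s : ℝ, 0 ≤ s → (NormedSpace.exp (s • Q) *ᵥ exitRates Q) j = 0 := fun s hs =>
    le_antisymm (hcon s hs) (exp_smul_mulVec_nonneg hQ (exitRates_nonneg hQ) hs j)
  have hconst : ∀ t : ℝ, 0 ≤ t → ∑ l, NormedSpace.exp (t • Q) j l = 1 := by
    intro t ht
    have h := constant_of_has_deriv_right_zero (a := 0) (b := t)
      (f := fun s : ℝ => ∑ l, NormedSpace.exp (s • Q) j l)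
      (fun s _ => (sum_exp_hasDerivAt Q j s).continuousAt.continuousWithinAt)
      (fun s hs => by
        have := (sum_exp_hasDerivAt Q j s).hasDerivWithinAt (s := Set.Ici s)
        rwa [hzero s hs.1, neg_zero] at this) t ⟨ht, le_rfl⟩
    rw [h]
    simp [Matrix.one_apply]
  have hlim : Tendsto (fun t : ℝ => ∑ l, NormedSpace.exp (t • Q) j l) atTop (𝓝 0) := by
    simpa using tendsto_finsetSum Finset.univ fun l _ => hQ.transient j l
  have hlim' : Tendsto (fun t : ℝ => ∑ l, NormedSpace.exp (t • Q) j l) atTop (𝓝 1) :=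
    tendsto_const_nhds.congr' ((eventually_ge_atTop 0).mono fun t ht => (hconst t ht).symm)
  exact zero_ne_one (tendsto_nhds_unique hlim hlim')

theorem continuous_vecMul_exp (β : X → ℝ) (Q : Matrix X X ℝ) (x : X) :
    Continuous fun t : ℝ => (β ᵥ* NormedSpace.exp (t • Q)) x :=
  continuous_iff_continuousAt.2 fun t => (hasDerivAt_vecMul_exp β Q t x).continuousAt

theorem continuous_vecMul_exp_dotProduct (β : X → ℝ) (Q : Matrix X X ℝ) (v : X → ℝ) :
    Continuous fun t : ℝ => (β ᵥ* NormedSpace.exp (t • Q)) ⬝ᵥ v :=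
  continuous_finsetSum _ fun x _ => (continuous_vecMul_exp β Q x).mul continuous_const

/-- From state `x` the exit density is some `c > 0` after a delay `s`. Hence `(β e^{tQ})_x` is at
most `c⁻¹` times the exit density at `t + s`, which is integrable with weight `tⁿ e^{-θt}` by
hypothesis. -/
theorem integrableOn_augInit_vecMul_exp {Q : Matrix X X ℝ} (hQ : IsSubintensity Q)
    {β : X → ℝ} (hβ : ∀ x, 0 ≤ β x) {n : ℕ} {θ y : ℝ} (hy : 0 ≤ y)
    (hint : IntegrableOn (fun t => t ^ n * Real.exp (-θ * t) *
      ((β ᵥ* NormedSpace.exp (t • Q)) ⬝ᵥ exitRates Q)) (Set.Ioi y))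
    (a : Fin (n + 1) × X) :
    IntegrableOn (fun t => (augInit n β ᵥ* NormedSpace.exp (t • augMatrix n θ Q)) a)
      (Set.Ioi y) := by
  obtain ⟨m, x⟩ := a
  obtain ⟨s, hs, hpos⟩ := hQ.exists_exit_pos x
  set c := (NormedSpace.exp (s • Q) *ᵥ exitRates Q) x with hc
  set g : ℝ → ℝ := fun t => t ^ n * Real.exp (-θ * t) *
      ((β ᵥ* NormedSpace.exp (t • Q)) ⬝ᵥ exitRates Q) with hg
  have hcont := continuous_vecMul_exp (augInit n β) (augMatrix n θ Q) (m, x)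
  have hgs : IntegrableOn (fun t => g (t + s)) (Set.Ioi (y + 1)) := by
    have h := ((measurePreserving_add_right volume s).integrableOn_comp_preimage
      (measurableEmbedding_addRight s) (f := g) (s := Set.Ioi y)).2 hint
    refine h.mono_set fun t ht => ?_
    simp only [Set.mem_preimage, Set.mem_Ioi] at ht ⊢
    linarith
  -- Continuity handles the bounded piece; beyond `y + 1` one has `t ≥ 1`, so the lower powers `t^m`
  -- are dominated by `tⁿ`.
  rw [← Set.Ioc_union_Ioi_eq_Ioi (show y ≤ y + 1 by linarith)]
  refine IntegrableOn.union hcont.integrableOn_Ioc ?_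
  refine Integrable.mono' (hgs.const_mul (c⁻¹ * Real.exp (θ * s))) hcont.aestronglyMeasurable ?_
  refine (ae_restrict_mem measurableSet_Ioi).mono fun t ht => ?_
  have ht : y + 1 < t := ht
  have ht0 : 0 ≤ t := by linarith
  have ht1 : 1 ≤ t := by linarith
  have hp := vecMul_exp_smul_nonneg hQ hβ ht0
  rw [augInit_vecMul_exp_augMatrix, Real.norm_of_nonneg
    (mul_nonneg (by positivity) (hp x))]
  have hkey : (β ᵥ* NormedSpace.exp (t • Q)) x * c ≤
      (β ᵥ* NormedSpace.exp ((t + s) • Q)) ⬝ᵥ exitRates Q := by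
    rw [exp_add_smul, ← Matrix.vecMul_vecMul, ← Matrix.dotProduct_mulVec]
    exact Finset.single_le_sum (f := fun z => (β ᵥ* NormedSpace.exp (t • Q)) z *
      (NormedSpace.exp (s • Q) *ᵥ exitRates Q) z)
      (fun z _ => mul_nonneg (hp z) (exp_smul_mulVec_nonneg hQ (exitRates_nonneg hQ) hs z))
      (Finset.mem_univ x)
  have hpow : t ^ (m : ℕ) / (m : ℕ).factorial ≤ (t + s) ^ n := by
    calc t ^ (m : ℕ) / (m : ℕ).factorial ≤ t ^ (m : ℕ) :=
          div_le_self (by positivity) (by exact_mod_cast Nat.one_le_iff_ne_zero.2 (Nat.factorial_ne_zero _))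
      _ ≤ t ^ n := pow_le_pow_right₀ ht1 (by omega)
      _ ≤ (t + s) ^ n := pow_le_pow_left₀ ht0 (by linarith) n
  have hexp : Real.exp (-θ * t) = Real.exp (θ * s) * Real.exp (-θ * (t + s)) := by
    rw [← Real.exp_add]; congr 1; ring
  calc t ^ (m : ℕ) / (m : ℕ).factorial * Real.exp (-θ * t) * (β ᵥ* NormedSpace.exp (t • Q)) x
      ≤ (t + s) ^ n * Real.exp (-θ * t) * (β ᵥ* NormedSpace.exp (t • Q)) x := by
        gcongr; exact hp x
    _ = c⁻¹ * Real.exp (θ * s) * ((t + s) ^ n * Real.exp (-θ * (t + s)) *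
          ((β ᵥ* NormedSpace.exp (t • Q)) x * c)) := by
        rw [hexp]; field_simp
    _ ≤ _ := by
        simp only [hg]
        gcongr

/-- Tail integrals `∫_y^∞ tⁿ e^{-θt} β e^{Qt} v dt` in terms of the augmented matrix. -/
theorem integral_tail_eq {Q : Matrix X X ℝ} (hQ : IsSubintensity Q)
    {β : X → ℝ} (hβ : ∀ x, 0 ≤ β x) {n : ℕ} {θ y : ℝ} (hy : 0 ≤ y)
    (hunit : IsUnit (augMatrix n θ Q))
    (hint : IntegrableOn (fun t => t ^ n * Real.exp (-θ * t) *
      ((β ᵥ* NormedSpace.exp (t • Q)) ⬝ᵥ exitRates Q)) (Set.Ioi y)) (v : X → ℝ) :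
    ∫ t in Set.Ioi y, t ^ n * Real.exp (-θ * t) * ((β ᵥ* NormedSpace.exp (t • Q)) ⬝ᵥ v) =
      n.factorial * ((augInit n β ᵥ* (NormedSpace.exp (y • augMatrix n θ Q) *
        (-augMatrix n θ Q)⁻¹)) ⬝ᵥ augExit n v) := by
  set A := augMatrix n θ Q with hA
  set W : ℝ → Fin (n + 1) × X → ℝ := fun t => augInit n β ᵥ* NormedSpace.exp (t • A) with hW
  have hWint : ∀ a, IntegrableOn (fun t => W t a) (Set.Ioi y) :=
    integrableOn_augInit_vecMul_exp hQ hβ hy hint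
  set I : Fin (n + 1) × X → ℝ := fun a => ∫ t in Set.Ioi y, W t a with hI
  have hIA : I ᵥ* A = -W y := by
    ext b
    have hderiv : ∀ t, HasDerivAt (fun s => W s b) ((W t ᵥ* A) b) t := fun t =>
      hasDerivAt_vecMul_exp _ A t b
    have hdint : IntegrableOn (fun t => (W t ᵥ* A) b) (Set.Ioi y) := by
      simp only [Matrix.vecMul, dotProduct]
      exact integrable_finsetSum _ fun a _ => (hWint a).mul_const _
    -- Integrability of both `W` and `W' = W A` forces `W → 0`, with no spectral condition on `A`.
    have hlim := tendsto_zero_of_hasDerivAt_of_integrableOn_Ioi (fun t _ => hderiv t) hdint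
      (hWint b)
    have h := integral_Ioi_of_hasDerivAt_of_tendsto' (fun t _ => hderiv t) hdint hlim
    rw [Pi.neg_apply, ← zero_sub, ← h]
    simp only [Matrix.vecMul, dotProduct]
    rw [integral_finsetSum _ fun a _ => (hWint a).mul_const _]
    simp only [integral_mul_const, hI]
  have hIeq : I = W y ᵥ* (-A)⁻¹ := by
    have hdet : IsUnit (-A).det := (Matrix.isUnit_iff_isUnit_det _).1 hunit.neg
    have : I ᵥ* (-A) = W y := by rw [Matrix.vecMul_neg, hIA, neg_neg]
    rw [← this, Matrix.vecMul_vecMul, Matrix.mul_nonsing_inv _ hdet, Matrix.vecMul_one]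
  have hdot : ∀ u : Fin (n + 1) × X → ℝ, u ⬝ᵥ augExit n v = ∑ x, u (Fin.last n, x) * v x := by
    intro u
    simp only [dotProduct, Fintype.sum_prod_type, augExit]
    rw [Finset.sum_eq_single (Fin.last n)]
    · simp
    · intro b _ hb
      simp [hb]
    · simp
  rw [← Matrix.vecMul_vecMul, show augInit n β ᵥ* NormedSpace.exp (y • A) = W y from rfl,
    ← hIeq, hdot, Finset.mul_sum]
  have hpt : ∀ t, t ^ n * Real.exp (-θ * t) * ((β ᵥ* NormedSpace.exp (t • Q)) ⬝ᵥ v) =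
      ∑ x, n.factorial * (W t (Fin.last n, x) * v x) := by
    intro t
    simp only [hW, hA, augInit_vecMul_exp_augMatrix, dotProduct, Finset.mul_sum, Fin.val_last]
    refine Finset.sum_congr rfl fun x _ => ?_
    field_simp
  simp only [hpt]
  rw [integral_finsetSum _ fun x _ => ((hWint (Fin.last n, x)).mul_const _).const_mul _]
  simp only [integral_const_mul, integral_mul_const, hI]

end TailIntegral

/-! ### Exit times of right-continuous processes -/

section ExitTime

variable {Ω X Y : Type*}

/-- The first time at which `A` is not in the range of `f`. -/
noncomputable def exitTime (A : ℝ≥0 → Ω → X) (f : Y → X) (ω : Ω) : ℝ≥0 :=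
  sInf {t : ℝ≥0 | A t ω ∉ Set.range f}

/-- Right-continuity of paths, for the discrete topology on the state space. -/
def IsRightContinuous (A : ℝ≥0 → Ω → X) : Prop :=
  ∀ (ω : Ω) (t : ℝ≥0), ∃ δ : ℝ≥0, 0 < δ ∧ ∀ s : ℝ≥0, t ≤ s → s < t + δ → A s ω = A t ω

theorem mem_range_of_lt_exitTime {A : ℝ≥0 → Ω → X} {f : Y → X} {ω : Ω} {t : ℝ≥0}
    (ht : t < exitTime A f ω) : A t ω ∈ Set.range f := by
  by_contra h
  exact notMem_of_lt_csInf ht (OrderBot.bddBelow _) h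

theorem exitTime_le {A : ℝ≥0 → Ω → X} {f : Y → X} {ω : Ω} {t : ℝ≥0}
    (ht : A t ω ∉ Set.range f) : exitTime A f ω ≤ t :=
  csInf_le (OrderBot.bddBelow _) ht

/-- Right-continuity makes the infimum attained. An exit must exist, since `sInf ∅ = 0` would give a
spurious exit time. -/
theorem IsRightContinuous.exitTime_notMem {A : ℝ≥0 → Ω → X} (hA : IsRightContinuous A)
    {f : Y → X} {ω : Ω} (hne : ∃ t, A t ω ∉ Set.range f) :
    A (exitTime A f ω) ω ∉ Set.range f := by
  obtain ⟨δ, hδ, h⟩ := hA ω (exitTime A f ω)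
  obtain ⟨s, hs, hlt⟩ := exists_lt_of_csInf_lt hne (lt_add_of_pos_right (exitTime A f ω) hδ)
  rw [← h s (exitTime_le hs) hlt]
  exact hs

/-- A right-continuous process takes its current value at some later point of a dense set. -/
theorem IsRightContinuous.exists_dense_eq {A : ℝ≥0 → Ω → X} (hA : IsRightContinuous A)
    {s : Set ℝ≥0} (hs : Dense s) (ω : Ω) {t u : ℝ≥0} (htu : t < u) :
    ∃ q ∈ s, t < q ∧ q < u ∧ A q ω = A t ω := by
  obtain ⟨δ, hδ, h⟩ := hA ω t
  obtain ⟨q, hq, h1, h2⟩ := hs.exists_between (lt_min htu (lt_add_of_pos_right t hδ))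
  exact ⟨q, hq, h1, h2.trans_le (min_le_left _ _), h q h1.le (h2.trans_le (min_le_right _ _))⟩

/-- The σ-algebra is left free: it is the ambient one for laws and the path σ-algebra for
independence. -/
theorem IsRightContinuous.measurable_exitTime {A : ℝ≥0 → Ω → X} (hA : IsRightContinuous A)
    {m : MeasurableSpace Ω} (f : Y → X) (hm : ∀ t, MeasurableSet {ω | A t ω ∉ Set.range f}) :
    Measurable (exitTime A f) := by
  obtain ⟨s, hsc, hsd⟩ := TopologicalSpace.exists_countable_dense ℝ≥0
  refine measurable_of_Iio fun y => ?_
  -- An exit before `y` is visible at a dense time before `y`. The second set collects the paths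
  -- that never exit, whose exit time is `sInf ∅ = 0`.
  have hset : exitTime A f ⁻¹' Set.Iio y =
      (⋃ q ∈ s ∩ Set.Iio y, {ω | A q ω ∉ Set.range f}) ∪
        ({_ω | 0 < y} ∩ ⋂ q ∈ s, {ω | A q ω ∉ Set.range f}ᶜ) := by
    ext ω
    simp only [Set.mem_preimage, Set.mem_Iio, Set.mem_union, Set.mem_iUnion, Set.mem_inter_iff,
      Set.mem_iInter, Set.mem_compl_iff, exists_prop, Set.mem_ofPred_eq]
    constructor
    · intro hlt
      by_cases hne : ∃ t, A t ω ∉ Set.range f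
      · obtain ⟨q, hq, _, h2, h3⟩ := hA.exists_dense_eq hsd ω hlt
        exact Or.inl ⟨q, ⟨hq, h2⟩, h3 ▸ hA.exitTime_notMem hne⟩
      · exact Or.inr ⟨lt_of_le_of_lt (by simp) hlt, fun q _ h => hne ⟨q, h⟩⟩
    · rintro (⟨q, ⟨_, hq⟩, h⟩ | ⟨hy, h⟩)
      · exact (exitTime_le h).trans_lt hq
      · have : {t : ℝ≥0 | A t ω ∉ Set.range f} = ∅ := by
          refine Set.eq_empty_of_forall_notMem fun t ht => ?_
          obtain ⟨q, hq, _, _, h3⟩ := hA.exists_dense_eq hsd ω (lt_add_one t)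
          exact h q hq (h3 ▸ ht)
        rw [exitTime, this]
        simpa using hy
  rw [hset]
  refine (MeasurableSet.biUnion (hsc.mono Set.inter_subset_left) fun q _ => hm q).union ?_
  exact (MeasurableSet.const _).inter (MeasurableSet.biInter hsc fun q _ => (hm q).compl)

end ExitTime

/-! ### Absorption of Markov jump processes -/

namespace IsMarkovJumpProcess

variable {Ω X Y : Type*} [MeasurableSpace Ω] [Fintype X] [DecidableEq X] {init : X → ℝ} {G : Matrix X X ℝ} {P : Measure Ω}
  {A : ℝ≥0 → Ω → X}

theorem isRightContinuous (hA : IsMarkovJumpProcess init G P A) : IsRightContinuous A :=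
  hA.rightContinuous

theorem measurableSet_mem (hA : IsMarkovJumpProcess init G P A) (t : ℝ≥0) (s : Set X) :
    MeasurableSet {ω | A t ω ∈ s} := by
  have : {ω | A t ω ∈ s} = ⋃ x ∈ s, {ω | A t ω = x} := by ext; simp
  rw [this]
  exact MeasurableSet.biUnion s.to_countable fun x _ => hA.measurableSet_eq t x

theorem real_eq [IsFiniteMeasure P] (hA : IsMarkovJumpProcess init G P A) (t : ℝ≥0) (x : X) :
    P.real {ω | A t ω = x} = (init ᵥ* NormedSpace.exp ((t : ℝ) • G)) x := by
  have h : ∀ i, P.real ({ω | A 0 ω = i} ∩ {ω | A t ω = x}) =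
      init i * NormedSpace.exp ((t : ℝ) • G) i x := by
    intro i
    have := hA.finiteDim 1 ![0, t] (by
      rw [Fin.monotone_iff_le_succ]; intro j; fin_cases j; simp) rfl ![i, x]
    simpa [Fin.forall_fin_two, Set.ofPred_and] using this
  have hU : {ω | A t ω = x} = ⋃ i, ({ω | A 0 ω = i} ∩ {ω | A t ω = x}) := by ext; simp
  rw [hU, measureReal_iUnion_fintype]
  · simp only [h]; rfl
  · intro i j hij
    exact Set.disjoint_left.2 fun ω h1 h2 => hij (h1.1.symm.trans h2.1)
  · exact fun i => (hA.measurableSet_eq 0 i).inter (hA.measurableSet_eq t x)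

theorem exp_absorbing {x : X} (hx : ∀ z, G x z = 0) (t : ℝ) (z : X) :
    NormedSpace.exp (t • G) x z = (1 : Matrix X X ℝ) x z := by
  have h := eq_vecMul_exp_of_hasDerivAt (A := G) (w := fun _ => Pi.single x 1) (fun t j => by
    rw [Matrix.single_one_vecMul]
    simpa [hx] using hasDerivAt_const t _) t
  rw [Matrix.single_one_vecMul] at h
  have h' := congrFun h z
  rw [Pi.single_apply] at h'
  rw [Matrix.one_apply]
  simpa [eq_comm] using h'.symm

/-- For two fixed times a departure from `x` has probability zero. A countable dense set of times
and right-continuity give one null set valid for all pairs. -/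
theorem ae_absorbed [IsFiniteMeasure P] (hA : IsMarkovJumpProcess init G P A) {x : X} (hx : ∀ z, G x z = 0) :
    ∀ᵐ ω ∂P, ∀ s t, s ≤ t → A s ω = x → A t ω = x := by
  have htwo : ∀ s t : ℝ≥0, s ≤ t → ∀ᵐ ω ∂P, A s ω = x → A t ω = x := by
    intro s t hst
    have h0 : ∀ i z, z ≠ x →
        P ({ω | A 0 ω = i} ∩ ({ω | A s ω = x} ∩ {ω | A t ω = z})) = 0 := by
      intro i z hz
      have := hA.finiteDim 2 ![0, s, t] (by
        rw [Fin.monotone_iff_le_succ]; intro j; fin_cases j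
        · simp
        · simpa using hst) rfl ![i, x, z]
      have h1 := exp_absorbing hx ((t : ℝ) - s) z
      rw [Matrix.one_apply_ne hz.symm] at h1
      simp only [Fin.forall_fin_succ, Fin.prod_univ_two] at this
      simp [h1, Set.ofPred_and] at this
      exact (measureReal_eq_zero_iff).1 this
    have hsub : {ω | ¬ (A s ω = x → A t ω = x)} ⊆
        ⋃ i, ⋃ z ∈ {z | z ≠ x}, {ω | A 0 ω = i} ∩ ({ω | A s ω = x} ∩ {ω | A t ω = z}) := by
      intro ω hω
      simp only [Set.mem_ofPred_eq, Classical.not_imp] at hω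
      simp [hω.1, hω.2]
    refine measure_mono_null hsub (measure_iUnion_null fun i => ?_)
    exact (measure_biUnion_null_iff (Set.to_countable _)).2 fun z hz => h0 i z hz
  obtain ⟨s, hsc, hsd⟩ := TopologicalSpace.exists_countable_dense ℝ≥0
  have hall : ∀ᵐ ω ∂P, ∀ q ∈ s, ∀ r ∈ s, q ≤ r → A q ω = x → A r ω = x := by
    refine (ae_ball_iff hsc).2 fun q _ => (ae_ball_iff hsc).2 fun r _ => ?_
    by_cases hqr : q ≤ r
    · filter_upwards [htwo q r hqr] with ω h _ using h
    · exact Eventually.of_forall fun ω h => absurd h hqr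
  filter_upwards [hall] with ω h u t hut hu
  rcases hut.eq_or_lt with rfl | hlt
  · exact hu
  obtain ⟨q, hq, _, h2, h3⟩ := hA.isRightContinuous.exists_dense_eq hsd ω hlt
  obtain ⟨r, hr, h4, _, h6⟩ := hA.isRightContinuous.exists_dense_eq hsd ω (lt_add_one t)
  rw [← h6]
  exact h q hq r hr (h2.trans h4).le (h3.trans hu)

theorem measurable_exitTime (hA : IsMarkovJumpProcess init G P A) (f : Y → X) :
    Measurable (exitTime A f) :=
  hA.isRightContinuous.measurable_exitTime f fun t => hA.measurableSet_mem t (Set.range f)ᶜ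

variable [IsFiniteMeasure P] {f : Y → X}

theorem ae_absorbed_of_notMem (hA : IsMarkovJumpProcess init G P A)
    (hG : ∀ x, x ∉ Set.range f → ∀ z, G x z = 0) :
    ∀ᵐ ω ∂P, ∀ s t, s ≤ t → A s ω ∉ Set.range f → A t ω = A s ω := by
  have h : ∀ x, x ∉ Set.range f → ∀ᵐ ω ∂P, ∀ s t, s ≤ t → A s ω = x → A t ω = x :=
    fun x hx => hA.ae_absorbed (hG x hx)
  filter_upwards [(ae_ball_iff (Set.to_countable {x | x ∉ Set.range f})).2 h] with ω hω s t hst hs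
  exact hω _ hs s t hst rfl

/-- After its exit the path is frozen, so the state at time `y` records both that the exit has
happened and where. -/
theorem exitTime_le_and_eq_ae (hA : IsMarkovJumpProcess init G P A)
    (hG : ∀ x, x ∉ Set.range f → ∀ z, G x z = 0) {x : X} (hx : x ∉ Set.range f) (y : ℝ≥0) :
    {ω | exitTime A f ω ≤ y ∧ A (exitTime A f ω) ω = x} =ᵐ[P] {ω | A y ω = x} := by
  refine eventuallyEq_set.2 ?_
  filter_upwards [hA.ae_absorbed_of_notMem hG] with ω h
  constructor
  · rintro ⟨hle, heq⟩
    exact (h _ _ hle (heq ▸ hx)).trans heq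
  · intro hy
    have hle : exitTime A f ω ≤ y := exitTime_le (by rw [hy]; exact hx)
    have hn := hA.isRightContinuous.exitTime_notMem (f := f) (ω := ω) ⟨y, by rw [hy]; exact hx⟩
    exact ⟨hle, (h _ _ hle hn).symm.trans hy⟩

/-- The path is evaluated at a random time, and the event agrees with events at fixed times only up
to null sets; hence null measurability. -/
theorem nullMeasurableSet_exit_eq (hA : IsMarkovJumpProcess init G P A)
    (hG : ∀ x, x ∉ Set.range f → ∀ z, G x z = 0) {x : X} (hx : x ∉ Set.range f) :
    NullMeasurableSet {ω | A (exitTime A f ω) ω = x} P := by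
  have h : {ω | A (exitTime A f ω) ω = x} =
      ⋃ n : ℕ, {ω | exitTime A f ω ≤ n ∧ A (exitTime A f ω) ω = x} := by
    ext ω
    simp only [Set.mem_iUnion, Set.mem_ofPred_eq, exists_and_right]
    exact ⟨fun h => ⟨exists_nat_ge _, h⟩, fun h => h.2⟩
  rw [h]
  exact NullMeasurableSet.iUnion fun n =>
    (hA.measurableSet_eq n x).nullMeasurableSet.congr (hA.exitTime_le_and_eq_ae hG hx n).symm

variable [Fintype Y] [DecidableEq Y]

/-- `P(A t = f j) = (β e^{tT})_j`, where `T` and `β` are the restrictions of the intensity matrix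
and of the initial distribution to the range of `f`. -/
theorem vecMul_exp_apply (hf : Function.Injective f)
    (hG : ∀ x, x ∉ Set.range f → ∀ z, G x z = 0) (hinit : ∀ x, x ∉ Set.range f → init x = 0)
    (t : ℝ) (j : Y) :
    (init ᵥ* NormedSpace.exp (t • G)) (f j) =
      ((init ∘ f) ᵥ* NormedSpace.exp (t • G.submatrix f f)) j := by
  simp only [Matrix.vecMul, dotProduct, ← exp_smul_submatrix hf hG]
  exact (Finset.sum_of_injOn f hf.injOn (by simp)
    (fun x _ hx => by rw [hinit x (by simpa using hx), zero_mul]) (fun _ _ => rfl)).symm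

theorem hasDerivAt_exit (hf : Function.Injective f)
    (hG : ∀ x, x ∉ Set.range f → ∀ z, G x z = 0) (hinit : ∀ x, x ∉ Set.range f → init x = 0)
    (x : X) (t : ℝ) :
    HasDerivAt (fun s : ℝ => (init ᵥ* NormedSpace.exp (s • G)) x)
      (((init ∘ f) ᵥ* NormedSpace.exp (t • G.submatrix f f)) ⬝ᵥ fun j => G (f j) x) t := by
  refine (hasDerivAt_vecMul_exp init G t x).congr_deriv ?_
  simp only [dotProduct, ← vecMul_exp_apply hf hG hinit]
  exact (Finset.sum_of_injOn f hf.injOn (by simp)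
    (fun z _ hz => mul_eq_zero_of_right _ (hG z (by simpa using hz) x)) (fun _ _ => rfl)).symm

/-- Never exiting implies being inside at each time `t`, which has probability tending to zero by
transience. -/
theorem ae_exists_exit (hA : IsMarkovJumpProcess init G P A) (hf : Function.Injective f)
    (hG : ∀ x, x ∉ Set.range f → ∀ z, G x z = 0) (hinit : ∀ x, x ∉ Set.range f → init x = 0)
    (hT : IsSubintensity (G.submatrix f f)) : ∀ᵐ ω ∂P, ∃ t, A t ω ∉ Set.range f := by
  have hprob : ∀ t : ℝ≥0, P.real {ω | ∀ t, A t ω ∈ Set.range f} ≤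
      ∑ j, ((init ∘ f) ᵥ* NormedSpace.exp ((t : ℝ) • G.submatrix f f)) j := by
    intro t
    have hsub : {ω | ∀ t, A t ω ∈ Set.range f} ⊆ ⋃ j, {ω | A t ω = f j} := by
      intro ω hω
      obtain ⟨j, hj⟩ := hω t
      exact Set.mem_iUnion.2 ⟨j, hj.symm⟩
    refine (measureReal_mono hsub).trans ((measureReal_iUnion_fintype_le _).trans_eq ?_)
    simp only [hA.real_eq, vecMul_exp_apply hf hG hinit]
  have hlim : Tendsto (fun t : ℝ≥0 =>
      ∑ j, ((init ∘ f) ᵥ* NormedSpace.exp ((t : ℝ) • G.submatrix f f)) j) atTop (𝓝 0) := by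
    have h : Tendsto (fun t : ℝ =>
        ∑ j, ((init ∘ f) ᵥ* NormedSpace.exp (t • G.submatrix f f)) j) atTop (𝓝 0) := by
      simp only [Matrix.vecMul, dotProduct]
      simpa using tendsto_finsetSum Finset.univ fun j _ => tendsto_finsetSum Finset.univ
        fun i _ => (hT.transient i j).const_mul ((init ∘ f) i)
    exact h.comp (NNReal.tendsto_coe_atTop.2 tendsto_id)
  have h0 : P.real {ω | ∀ t, A t ω ∈ Set.range f} = 0 :=
    le_antisymm (ge_of_tendsto' hlim hprob) measureReal_nonneg
  rw [ae_iff]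
  simpa using (measureReal_eq_zero_iff).1 h0

/-- The law of the exit time, on the event that the exit takes place to the state `x`. -/
theorem map_exitTime (hA : IsMarkovJumpProcess init G P A) (hf : Function.Injective f)
    (hG : ∀ x, x ∉ Set.range f → ∀ z, G x z = 0) (hinit : ∀ x, x ∉ Set.range f → init x = 0)
    (hT : IsSubintensity (G.submatrix f f)) (hinit' : ∀ j, 0 ≤ init (f j))
    {x : X} (hx : x ∉ Set.range f) (hGx : ∀ j, 0 ≤ G (f j) x) :
    (P.restrict {ω | A (exitTime A f ω) ω = x}).map (fun ω => (exitTime A f ω : ℝ)) =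
      (volume.restrict (Set.Ioi 0)).withDensity (fun t => ENNReal.ofReal
        (((init ∘ f) ᵥ* NormedSpace.exp (t • G.submatrix f f)) ⬝ᵥ fun j => G (f j) x)) := by
  set g : ℝ → ℝ := fun t =>
    ((init ∘ f) ᵥ* NormedSpace.exp (t • G.submatrix f f)) ⬝ᵥ fun j => G (f j) x with hg
  have hgc : Continuous g := continuous_vecMul_exp_dotProduct _ _ _
  have hg0 : ∀ t, 0 ≤ t → 0 ≤ g t := fun t ht =>
    Finset.sum_nonneg fun j _ => mul_nonneg (vecMul_exp_smul_nonneg hT hinit' ht j) (hGx j)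
  have hmeas : Measurable (fun ω => (exitTime A f ω : ℝ)) :=
    measurable_coe_nnreal_real.comp (hA.measurable_exitTime f)
  -- Distribution functions are compared: `P(A y = x)` is the integral of its derivative over `[0,
  -- y]`, with initial value `init x = 0`.
  refine Measure.ext_of_Iic _ _ fun y => ?_
  rw [Measure.map_apply hmeas measurableSet_Iic,
    Measure.restrict_apply (hmeas measurableSet_Iic), withDensity_apply _ measurableSet_Iic,
    Measure.restrict_restrict measurableSet_Iic, Set.inter_comm (Set.Iic y), Set.Ioi_inter_Iic]
  rcases lt_or_ge y 0 with hy | hy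
  · rw [Set.Ioc_eq_empty (by linarith)]
    have : (fun ω => (exitTime A f ω : ℝ)) ⁻¹' Set.Iic y = ∅ :=
      Set.eq_empty_of_forall_notMem fun ω hω =>
        absurd (NNReal.coe_nonneg (exitTime A f ω)) (by
          simp only [Set.mem_preimage, Set.mem_Iic] at hω; linarith)
    simp [this]
  · lift y to ℝ≥0 using hy
    have hset : (fun ω => (exitTime A f ω : ℝ)) ⁻¹' Set.Iic (y : ℝ) ∩
        {ω | A (exitTime A f ω) ω = x} =
        {ω | exitTime A f ω ≤ y ∧ A (exitTime A f ω) ω = x} := by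
      ext ω; simp
    rw [hset, measure_congr (hA.exitTime_le_and_eq_ae hG hx y),
      ← ofReal_measureReal, hA.real_eq,
      ← ofReal_integral_eq_lintegral_ofReal hgc.integrableOn_Ioc
        ((ae_restrict_mem measurableSet_Ioc).mono fun t ht => hg0 t ht.1.le),
      ← intervalIntegral.integral_of_le y.coe_nonneg,
      intervalIntegral.integral_eq_sub_of_hasDerivAt
        (fun t _ => hasDerivAt_exit hf hG hinit x t) (hgc.intervalIntegrable _ _)]
    simp [hinit x hx]

theorem setLIntegral_exitTime (hA : IsMarkovJumpProcess init G P A) (hf : Function.Injective f)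
    (hG : ∀ x, x ∉ Set.range f → ∀ z, G x z = 0) (hinit : ∀ x, x ∉ Set.range f → init x = 0)
    (hT : IsSubintensity (G.submatrix f f)) (hinit' : ∀ j, 0 ≤ init (f j))
    {x : X} (hx : x ∉ Set.range f) (hGx : ∀ j, 0 ≤ G (f j) x) {φ : ℝ → ENNReal}
    (hφ : Measurable φ) :
    ∫⁻ ω in {ω | A (exitTime A f ω) ω = x}, φ (exitTime A f ω) ∂P =
      ∫⁻ t in Set.Ioi 0, ENNReal.ofReal
        (((init ∘ f) ᵥ* NormedSpace.exp (t • G.submatrix f f)) ⬝ᵥ fun j => G (f j) x) * φ t := by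
  have hmeas : Measurable (fun ω => (exitTime A f ω : ℝ)) :=
    measurable_coe_nnreal_real.comp (hA.measurable_exitTime f)
  rw [← lintegral_map hφ hmeas, hA.map_exitTime hf hG hinit hT hinit' hx hGx,
    lintegral_withDensity_eq_lintegral_mul _ _ hφ]
  · rfl
  · exact (continuous_vecMul_exp_dotProduct _ _ _).measurable.ennreal_ofReal

end IsMarkovJumpProcess

/-! ### Residual lifetimes -/

section Residual

variable {Ω E S : Type*}

/-- The embedding of `S` into `E ∪ S ∪ {∂}`. -/
def alive (E S : Type*) (k : S) : E ⊕ (S ⊕ Unit) := Sum.inr (Sum.inl k)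

theorem alive_injective : Function.Injective (alive E S) :=
  Sum.inr_injective.comp Sum.inl_injective

/-- Pathwise, the time spent in `S` is the exit time from `S` of the process restarted at the
shock, if that process leaves `S` for good. -/
theorem residualTime_eq_exitTime {J₁₂ : ℝ≥0 → Ω → E ⊕ S} {J : ℝ≥0 → Ω → E ⊕ (S ⊕ Unit)} {ω : Ω}
    (hco : ∀ t, t ≤ shockTime J₁₂ ω → J t ω = Sum.map id Sum.inl (J₁₂ t ω))
    (habs : ∀ t, exitTime (afterShock J₁₂ J) (alive E S) ω ≤ t →
      afterShock J₁₂ J t ω ∉ Set.range (alive E S)) :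
    residualTime J ω = exitTime (afterShock J₁₂ J) (alive E S) ω := by
  set τ := shockTime J₁₂ ω with hτ
  set σ := exitTime (afterShock J₁₂ J) (alive E S) ω with hσ
  -- Before `τ` the path is in `E`; from `τ` on it is the restarted path, which is in `S` exactly up
  -- to `σ`.
  have hset : {t : ℝ | 0 ≤ t ∧ J t.toNNReal ω ∈
      Set.range (fun k : S => (Sum.inr (Sum.inl k) : E ⊕ (S ⊕ Unit)))} =
      Set.Ico (τ : ℝ) (τ + σ) := by
    ext t
    constructor
    · rintro ⟨ht, hmem⟩
      lift t to ℝ≥0 using ht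
      rw [Real.toNNReal_coe] at hmem
      have hle : τ ≤ t := by
        by_contra! hlt
        rw [hco t hlt.le] at hmem
        obtain ⟨e, he⟩ := mem_range_of_lt_exitTime (A := J₁₂) (f := Sum.inl) hlt
        rw [← he] at hmem
        simp at hmem
      refine ⟨NNReal.coe_le_coe.2 hle, ?_⟩
      by_contra! hge
      have hge' : τ + σ ≤ t := by exact_mod_cast hge
      obtain ⟨u, rfl⟩ := exists_add_of_le hle
      exact habs u ((add_le_add_iff_left τ).1 hge') hmem
    · rintro ⟨h1, h2⟩
      have ht : 0 ≤ t := τ.coe_nonneg.trans h1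
      lift t to ℝ≥0 using ht
      refine ⟨t.coe_nonneg, ?_⟩
      rw [Real.toNNReal_coe]
      obtain ⟨u, rfl⟩ := exists_add_of_le (NNReal.coe_le_coe.1 h1)
      have hu : u < σ := (add_lt_add_iff_left τ).1 (by exact_mod_cast h2)
      exact mem_range_of_lt_exitTime (A := afterShock J₁₂ J) (f := alive E S) hu
  rw [residualTime, hset, Real.volume_Ico]
  simp

theorem residualIntensity_row_eq_zero [Fintype S] {Q : Matrix S S ℝ} (x : E ⊕ (S ⊕ Unit)) (hx : x ∉ Set.range (alive E S))
    (z : E ⊕ (S ⊕ Unit)) : residualIntensity (E := E) Q x z = 0 := by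
  rcases x with e | s | u
  · rcases z with z | z <;> rfl
  · exact absurd ⟨s, rfl⟩ hx
  · rcases z with z | z | z <;> rfl

theorem single_alive_eq_zero [DecidableEq E] [DecidableEq S] {k : S} (x : E ⊕ (S ⊕ Unit)) (hx : x ∉ Set.range (alive E S)) :
    (Pi.single (Sum.inr (Sum.inl k)) 1 : E ⊕ (S ⊕ Unit) → ℝ) x = 0 :=
  Pi.single_eq_of_ne (fun h => hx ⟨k, h.symm⟩) _

theorem single_comp_alive [DecidableEq E] [DecidableEq S] {k : S} :
    (Pi.single (Sum.inr (Sum.inl k)) 1 : E ⊕ (S ⊕ Unit) → ℝ) ∘ alive E S = Pi.single k 1 := by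
  ext j
  simp [alive, Pi.single_apply]

variable [Fintype E] [DecidableEq E] [Fintype S] [DecidableEq S] [MeasurableSpace Ω]
  {P : Measure Ω} [IsFiniteMeasure P] {Q : Matrix S S ℝ} {k : S}
  {B : ℝ≥0 → Ω → E ⊕ (S ⊕ Unit)}

theorem residual_setLIntegral
    (hB : IsMarkovJumpProcess (Pi.single (Sum.inr (Sum.inl k)) 1) (residualIntensity Q) P B)
    (hQ : IsSubintensity Q) {x : E ⊕ (S ⊕ Unit)} (hx : x ∉ Set.range (alive E S))
    (hGx : ∀ j, 0 ≤ residualIntensity Q (alive E S j) x) {φ : ℝ → ENNReal}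
    (hφ : Measurable φ) :
    ∫⁻ ω in {ω | B (exitTime B (alive E S) ω) ω = x}, φ (exitTime B (alive E S) ω) ∂P =
      ∫⁻ t in Set.Ioi 0, ENNReal.ofReal
        ((Pi.single k 1 ᵥ* NormedSpace.exp (t • Q)) ⬝ᵥ
          fun j => residualIntensity Q (alive E S j) x) * φ t := by
  have h := hB.setLIntegral_exitTime alive_injective residualIntensity_row_eq_zero
    single_alive_eq_zero hQ
    (fun j => by
      have := congrFun (single_comp_alive (E := E) (k := k)) j
      simp only [Function.comp_apply] at this
      rw [this, Pi.single_apply]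
      split_ifs <;> norm_num) hx hGx hφ
  rw [single_comp_alive] at h
  exact h

theorem residual_ae_exists_exit
    (hB : IsMarkovJumpProcess (Pi.single (Sum.inr (Sum.inl k)) 1) (residualIntensity Q) P B)
    (hQ : IsSubintensity Q) : ∀ᵐ ω ∂P, ∃ t, B t ω ∉ Set.range (alive E S) :=
  hB.ae_exists_exit alive_injective residualIntensity_row_eq_zero single_alive_eq_zero hQ

/-- The state space formally contains `E`, but the rates from `S` into `E` are zero, so the exit can
only be to `∂`. -/
theorem residual_ae_exit_eq
    (hB : IsMarkovJumpProcess (Pi.single (Sum.inr (Sum.inl k)) 1) (residualIntensity Q) P B)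
    (hQ : IsSubintensity Q) :
    ∀ᵐ ω ∂P, B (exitTime B (alive E S) ω) ω = Sum.inr (Sum.inr ()) := by
  have h : ∀ e : E, ∀ᵐ ω ∂P, B (exitTime B (alive E S) ω) ω ≠ Sum.inl e := by
    intro e
    have h0 : ∀ j, residualIntensity Q (alive E S j) (Sum.inl e) = 0 := fun j => rfl
    have := residual_setLIntegral hB hQ (x := Sum.inl e) (by simp [alive]) (fun j => (h0 j).ge)
      (φ := fun _ => 1) measurable_const
    rw [ae_iff]
    simpa [h0, dotProduct] using this
  filter_upwards [ae_all_iff.2 h, residual_ae_exists_exit hB hQ] with ω h1 h2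
  have h3 := hB.isRightContinuous.exitTime_notMem h2
  rcases hx : B (exitTime B (alive E S) ω) ω with e | s | u
  · exact absurd hx (h1 e)
  · exact absurd ⟨s, hx.symm⟩ h3
  · rfl

/-- The law of the residual lifetime. -/
theorem residual_lintegral
    (hB : IsMarkovJumpProcess (Pi.single (Sum.inr (Sum.inl k)) 1) (residualIntensity Q) P B)
    (hQ : IsSubintensity Q) {φ : ℝ → ENNReal} (hφ : Measurable φ) :
    ∫⁻ ω, φ (exitTime B (alive E S) ω) ∂P =
      ∫⁻ t in Set.Ioi 0, ENNReal.ofReal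
        ((Pi.single k 1 ᵥ* NormedSpace.exp (t • Q)) ⬝ᵥ exitRates Q) * φ t := by
  have hG : (fun j => residualIntensity Q (alive E S j) (Sum.inr (Sum.inr ()))) = exitRates Q :=
    rfl
  have h := residual_setLIntegral hB hQ (x := Sum.inr (Sum.inr ())) (by simp [alive])
    (fun j => (exitRates_nonneg hQ j).trans_eq (congrFun hG j).symm) hφ
  rw [hG] at h
  have hae : ∀ᵐ ω ∂P, ω ∈ {ω | B (exitTime B (alive E S) ω) ω = Sum.inr (Sum.inr ())} :=
    residual_ae_exit_eq hB hQ
  rw [← h, Measure.restrict_eq_self_of_ae_mem hae]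

theorem residual_ae_absorbed
    (hB : IsMarkovJumpProcess (Pi.single (Sum.inr (Sum.inl k)) 1) (residualIntensity Q) P B)
    (hQ : IsSubintensity Q) :
    ∀ᵐ ω ∂P, ∀ t, exitTime B (alive E S) ω ≤ t → B t ω ∉ Set.range (alive E S) := by
  filter_upwards [hB.ae_absorbed_of_notMem residualIntensity_row_eq_zero,
    residual_ae_exists_exit hB hQ] with ω h1 h2 t ht
  have h3 := hB.isRightContinuous.exitTime_notMem h2
  rw [h1 _ t ht h3]
  exact h3

end Residual

/-! ### Conditioning on the state entered at the shock -/

section Factorization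

theorem pathSigma_measurableSet {Ω X : Type*} (J : ℝ≥0 → Ω → X) (t : ℝ≥0) (s : Set X) :
    MeasurableSet[pathSigma J] {ω | J t ω ∈ s} :=
  (le_iSup (fun t => MeasurableSpace.comap (J t) ⊤) t) _ ⟨s, trivial, rfl⟩

/-- The factor `tⁿ e^{-θt} 1{t > y}` of the tilted, truncated moment. -/
noncomputable def tiltedFactor (n : ℕ) (θ y t : ℝ) : ℝ :=
  open Classical in t ^ n * Real.exp (-θ * t) * if y < t then 1 else 0

theorem tiltedFactor_nonneg {n : ℕ} {θ y t : ℝ} (ht : 0 ≤ t) : 0 ≤ tiltedFactor n θ y t := by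
  unfold tiltedFactor
  split_ifs <;> positivity

theorem measurable_tiltedFactor (n : ℕ) (θ y : ℝ) : Measurable (tiltedFactor n θ y) := by
  unfold tiltedFactor
  exact (by fun_prop : Measurable fun t : ℝ => t ^ n * Real.exp (-θ * t)).mul
    (Measurable.ite measurableSet_Ioi measurable_const measurable_const)

theorem tiltedTruncated_eq (n₁₂ n₁ n₂ : ℕ) (θ₁₂ θ₁ θ₂ y₁₂ y₁ y₂ t₁₂ t₁ t₂ : ℝ) :
    tiltedTruncated n₁₂ n₁ n₂ θ₁₂ θ₁ θ₂ y₁₂ y₁ y₂ t₁₂ t₁ t₂ =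
      tiltedFactor n₁₂ θ₁₂ y₁₂ t₁₂ * tiltedFactor n₁ θ₁ y₁ t₁ * tiltedFactor n₂ θ₂ y₂ t₂ := by
  unfold tiltedTruncated tiltedFactor
  by_cases h1 : y₁₂ < t₁₂ <;> by_cases h2 : y₁ < t₁ <;> by_cases h3 : y₂ < t₂ <;>
    simp [h1, h2, h3]

theorem lintegral_mul_tiltedFactor {n : ℕ} {θ y : ℝ} (hy : 0 ≤ y) {g : ℝ → ℝ}
    (hg : ∀ t, 0 ≤ t → 0 ≤ g t) :
    ∫⁻ t in Set.Ioi 0, ENNReal.ofReal (g t) * ENNReal.ofReal (tiltedFactor n θ y t) =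
      ∫⁻ t in Set.Ioi y, ENNReal.ofReal (t ^ n * Real.exp (-θ * t) * g t) := by
  rw [← lintegral_indicator measurableSet_Ioi, ← lintegral_indicator measurableSet_Ioi]
  refine lintegral_congr fun t => ?_
  by_cases ht : y < t
  · have ht0 : 0 < t := hy.trans_lt ht
    rw [Set.indicator_of_mem (Set.mem_Ioi.2 ht0), Set.indicator_of_mem (Set.mem_Ioi.2 ht),
      ← ENNReal.ofReal_mul (hg t ht0.le), tiltedFactor, if_pos ht, mul_one, mul_comm]
  · rw [Set.indicator_of_notMem (s := Set.Ioi y) (by simpa using ht)]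
    refine Set.indicator_apply_eq_zero.2 fun _ => ?_
    rw [tiltedFactor, if_neg ht]
    simp

theorem jointIntensity_row_eq_zero {E S : Type*} {T : Matrix E E ℝ} {U : Matrix E S ℝ}
    (x : E ⊕ S) (hx : x ∉ Set.range (Sum.inl : E → E ⊕ S))
    (z : E ⊕ S) : jointIntensity T U x z = 0 := by
  rcases x with e | s
  · exact absurd ⟨e, rfl⟩ hx
  · rcases z with z | z <;> rfl

theorem sum_elim_eq_zero {E S : Type*} {α : E → ℝ} (x : E ⊕ S) (hx : x ∉ Set.range (Sum.inl : E → E ⊕ S)) :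
    Sum.elim α 0 x = 0 := by
  rcases x with e | s
  · exact absurd ⟨e, rfl⟩ hx
  · rfl

variable {Ω E S : Type*} [MeasurableSpace Ω] [Fintype E] [DecidableEq E] [Fintype S]
  [DecidableEq S] {P : Measure Ω} [IsProbabilityMeasure P] {α : E → ℝ} {T : Matrix E E ℝ}
  {U : Matrix E S ℝ} {Q₁ Q₂ : Matrix S S ℝ} {J₁₂ : ℝ≥0 → Ω → E ⊕ S}
  {J₁ J₂ : ℝ≥0 → Ω → E ⊕ (S ⊕ Unit)}

/-- The joint law of the shock time and the state entered at the shock. -/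
theorem IsCommonShock.setLIntegral_shockTime (hJ : IsCommonShock α T U Q₁ Q₂ P J₁₂ J₁ J₂) (k : S)
    {φ : ℝ → ENNReal} (hφ : Measurable φ) :
    ∫⁻ ω in {ω | shockState J₁₂ ω = Sum.inr k}, φ (shockTime J₁₂ ω) ∂P =
      ∫⁻ t in Set.Ioi 0, ENNReal.ofReal
        ((α ᵥ* NormedSpace.exp (t • T)) ⬝ᵥ fun j => U j k) * φ t :=
  hJ.joint.setLIntegral_exitTime (x := Sum.inr k) Sum.inl_injective jointIntensity_row_eq_zero sum_elim_eq_zero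
    hJ.param.subintensity_T hJ.param.init_nonneg (by simp) (fun j => hJ.param.U_nonneg j k) hφ

theorem IsCommonShock.ae_exists_shockState (hJ : IsCommonShock α T U Q₁ Q₂ P J₁₂ J₁ J₂) :
    ∀ᵐ ω ∂P, ∃ k : S, shockState J₁₂ ω = Sum.inr k := by
  filter_upwards [hJ.joint.ae_exists_exit Sum.inl_injective jointIntensity_row_eq_zero
    sum_elim_eq_zero hJ.param.subintensity_T] with ω h
  have h3 := hJ.joint.isRightContinuous.exitTime_notMem h
  rcases hx : J₁₂ (exitTime J₁₂ Sum.inl ω) ω with e | s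
  · exact absurd ⟨e, hx.symm⟩ h3
  · exact ⟨s, hx⟩

theorem IsCommonShock.nullMeasurableSet_shockState (hJ : IsCommonShock α T U Q₁ Q₂ P J₁₂ J₁ J₂)
    (k : S) : NullMeasurableSet {ω | shockState J₁₂ ω = Sum.inr k} P :=
  hJ.joint.nullMeasurableSet_exit_eq (f := Sum.inl) jointIntensity_row_eq_zero (by simp)

/-- Given the state entered at the shock, the expectation of a product factorizes. -/
theorem IsCommonShock.setLIntegral_prod (hJ : IsCommonShock α T U Q₁ Q₂ P J₁₂ J₁ J₂) (k : S)
    {φ φ₁ φ₂ : ℝ → ENNReal} (hφ : Measurable φ) (hφ₁ : Measurable φ₁) (hφ₂ : Measurable φ₂) :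
    ∫⁻ ω in {ω | shockState J₁₂ ω = Sum.inr k},
        φ (shockTime J₁₂ ω) * φ₁ (residualTime J₁ ω) * φ₂ (residualTime J₂ ω) ∂P =
      (∫⁻ t in Set.Ioi 0, ENNReal.ofReal
        ((α ᵥ* NormedSpace.exp (t • T)) ⬝ᵥ fun j => U j k) * φ t) *
      (∫⁻ t in Set.Ioi 0, ENNReal.ofReal
        ((Pi.single k 1 ᵥ* NormedSpace.exp (t • Q₁)) ⬝ᵥ exitRates Q₁) * φ₁ t) *
      (∫⁻ t in Set.Ioi 0, ENNReal.ofReal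
        ((Pi.single k 1 ᵥ* NormedSpace.exp (t • Q₂)) ⬝ᵥ exitRates Q₂) * φ₂ t) := by
  rw [← hJ.setLIntegral_shockTime k hφ]
  set s := {ω | shockState J₁₂ ω = Sum.inr k} with hs
  -- On a null event no conditional law is available, but both sides vanish: the first factor on the
  -- right is already an integral over `s`.
  by_cases h0 : P s = 0
  · simp [Measure.restrict_eq_zero.2 h0]
  set P' := P[|s] with hP'
  have hprob : IsProbabilityMeasure P' := cond_isProbabilityMeasure h0
  have hrestr : P.restrict s = P s • P' := by
    rw [hP', ProbabilityTheory.cond, smul_smul, ENNReal.mul_inv_cancel h0 (measure_ne_top _ _),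
      one_smul]
  have hB₁ := hJ.residual₁ k h0
  have hB₂ := hJ.residual₂ k h0
  rw [hrestr, lintegral_smul_measure, lintegral_smul_measure,
    ← residual_lintegral hB₁ hJ.param.subintensity_Q₁ hφ₁,
    ← residual_lintegral hB₂ hJ.param.subintensity_Q₂ hφ₂]
  have hcongr : ∀ᵐ ω ∂P', φ (shockTime J₁₂ ω) * φ₁ (residualTime J₁ ω) * φ₂ (residualTime J₂ ω) =
      φ (shockTime J₁₂ ω) * φ₁ (exitTime (afterShock J₁₂ J₁) (alive E S) ω) *
        φ₂ (exitTime (afterShock J₁₂ J₂) (alive E S) ω) := by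
    filter_upwards [residual_ae_absorbed hB₁ hJ.param.subintensity_Q₁,
      residual_ae_absorbed hB₂ hJ.param.subintensity_Q₂] with ω h1 h2
    rw [residualTime_eq_exitTime (hJ.coincide₁ ω) h1, residualTime_eq_exitTime (hJ.coincide₂ ω) h2]
  rw [lintegral_congr_ae hcongr]
  have hm : Measurable[pathSigma J₁₂] fun ω => φ (shockTime J₁₂ ω) :=
    (hφ.comp measurable_coe_nnreal_real).comp
      (hJ.joint.isRightContinuous.measurable_exitTime (m := pathSigma J₁₂) Sum.inl
        fun t => pathSigma_measurableSet J₁₂ t (Set.range Sum.inl)ᶜ)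
  have hm₁ : Measurable[pathSigma (afterShock J₁₂ J₁)]
      fun ω => φ₁ (exitTime (afterShock J₁₂ J₁) (alive E S) ω) :=
    (hφ₁.comp measurable_coe_nnreal_real).comp
      (hB₁.isRightContinuous.measurable_exitTime (m := pathSigma (afterShock J₁₂ J₁)) _
        fun t => pathSigma_measurableSet _ t (Set.range (alive E S))ᶜ)
  have hm₂ : Measurable[pathSigma (afterShock J₁₂ J₂)]
      fun ω => φ₂ (exitTime (afterShock J₁₂ J₂) (alive E S) ω) :=
    (hφ₂.comp measurable_coe_nnreal_real).comp
      (hB₂.isRightContinuous.measurable_exitTime (m := pathSigma (afterShock J₁₂ J₂)) _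
        fun t => pathSigma_measurableSet _ t (Set.range (alive E S))ᶜ)
  have hind : iIndepFun ![fun ω => φ (shockTime J₁₂ ω),
      fun ω => φ₁ (exitTime (afterShock J₁₂ J₁) (alive E S) ω),
      fun ω => φ₂ (exitTime (afterShock J₁₂ J₂) (alive E S) ω)] P' := by
    refine iIndep_of_iIndep_of_le (hJ.indep k h0) fun i => ?_
    fin_cases i
    · exact hm.comap_le
    · exact hm₁.comap_le
    · exact hm₂.comap_le
  have hprod := lintegral_prod_eq_prod_lintegral_of_indepFun Finset.univ _ hind (by
    intro i
    fin_cases i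
    · exact (hφ.comp measurable_coe_nnreal_real).comp (hJ.joint.measurable_exitTime Sum.inl)
    · exact (hφ₁.comp measurable_coe_nnreal_real).comp (hB₁.measurable_exitTime _)
    · exact (hφ₂.comp measurable_coe_nnreal_real).comp (hB₂.measurable_exitTime _))
  simp only [Fin.prod_univ_three] at hprod
  refine (congrArg (P s • ·) hprod).trans ?_
  simp only [smul_eq_mul, Matrix.cons_val, mul_assoc, hP', hs]

end Factorization

/-! ### The tail integrals as matrix expressions -/

section Assembly

variable {X : Type*} [Fintype X] [DecidableEq X]

theorem tail_nonneg {Q : Matrix X X ℝ} (hQ : IsSubintensity Q)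
    {β : X → ℝ} (hβ : ∀ x, 0 ≤ β x) {v : X → ℝ} (hv : ∀ x, 0 ≤ v x) {n : ℕ} {θ t : ℝ}
    (ht : 0 ≤ t) :
    0 ≤ t ^ n * Real.exp (-θ * t) * ((β ᵥ* NormedSpace.exp (t • Q)) ⬝ᵥ v) :=
  mul_nonneg (by positivity) (dotProduct_nonneg_of_nonneg (vecMul_exp_smul_nonneg hQ hβ ht) hv)

/-- The exit density integrates over `(y, ∞)` to the survival probability at `y`. If that were zero,
row `k` of the invertible matrix `e^{yQ}` would vanish. -/
theorem IsSubintensity.setLIntegral_exit_ne_zero {Q : Matrix X X ℝ} (hQ : IsSubintensity Q)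
    (k : X) (n : ℕ) (θ : ℝ) {y : ℝ} (hy : 0 ≤ y) :
    ∫⁻ t in Set.Ioi y, ENNReal.ofReal (t ^ n * Real.exp (-θ * t) *
      ((Pi.single k 1 ᵥ* NormedSpace.exp (t • Q)) ⬝ᵥ exitRates Q)) ≠ 0 := by
  intro h0
  have hdot : ∀ t : ℝ, (Pi.single k 1 ᵥ* NormedSpace.exp (t • Q)) ⬝ᵥ exitRates Q =
      (NormedSpace.exp (t • Q) *ᵥ exitRates Q) k := fun t => by
    rw [Matrix.single_one_vecMul]; rfl
  have hcont := continuous_vecMul_exp_dotProduct (Pi.single k 1) Q (exitRates Q)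
  rw [lintegral_eq_zero_iff (by fun_prop)] at h0
  have hzero : ∀ᵐ t ∂volume.restrict (Set.Ioi y),
      -((NormedSpace.exp (t • Q) *ᵥ exitRates Q) k) = 0 := by
    filter_upwards [h0, ae_restrict_mem measurableSet_Ioi] with t ht hyt
    have hpos : 0 < t := hy.trans_lt hyt
    simp only [Pi.zero_apply, ENNReal.ofReal_eq_zero, hdot] at ht
    have h1 := exp_smul_mulVec_nonneg hQ (exitRates_nonneg hQ) hpos.le k
    have h2 := nonpos_of_mul_nonpos_right ht (by positivity)
    linarith
  have hlim : Tendsto (fun t : ℝ => ∑ l, NormedSpace.exp (t • Q) k l) atTop (𝓝 0) := by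
    simpa using tendsto_finsetSum Finset.univ fun l _ => hQ.transient k l
  have hS := integral_Ioi_of_hasDerivAt_of_tendsto'
    (fun t _ => IsSubintensity.sum_exp_hasDerivAt Q k t)
    ((integrable_zero ℝ ℝ (volume.restrict (Set.Ioi y))).congr
      (hzero.mono fun t ht => ht.symm)) hlim
  rw [integral_eq_zero_of_ae hzero, zero_sub, eq_comm, neg_eq_zero,
    Finset.sum_eq_zero_iff_of_nonneg
      fun l _ => exp_smul_apply_nonneg hQ.offDiag_nonneg hy k l] at hS
  have h1 := congrFun (congrFun (exp_smul_mul_exp_neg_smul Q y) k) k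
  rw [Matrix.mul_apply, Matrix.one_apply_eq] at h1
  rw [Finset.sum_eq_zero fun l _ => by rw [hS l (Finset.mem_univ l), zero_mul]] at h1
  exact zero_ne_one h1

theorem integrableOn_tail_of_setLIntegral_ne_top {Q : Matrix X X ℝ} (hQ : IsSubintensity Q)
    {β : X → ℝ} (hβ : ∀ x, 0 ≤ β x) {v : X → ℝ} (hv : ∀ x, 0 ≤ v x) {n : ℕ} {θ y : ℝ}
    (hy : 0 ≤ y)
    (h : ∫⁻ t in Set.Ioi y, ENNReal.ofReal (t ^ n * Real.exp (-θ * t) *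
      ((β ᵥ* NormedSpace.exp (t • Q)) ⬝ᵥ v)) ≠ ⊤) :
    IntegrableOn (fun t => t ^ n * Real.exp (-θ * t) *
      ((β ᵥ* NormedSpace.exp (t • Q)) ⬝ᵥ v)) (Set.Ioi y) := by
  have hcont := continuous_vecMul_exp_dotProduct β Q v
  refine (lintegral_ofReal_ne_top_iff_integrable ?_ ?_).1 h
  · exact Continuous.aestronglyMeasurable (by fun_prop)
  · exact (ae_restrict_mem measurableSet_Ioi).mono fun t ht =>
      tail_nonneg hQ hβ hv (hy.trans (Set.mem_Ioi.1 ht).le)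

/-- Finiteness is required against the exit rates, not against `v`: in the application to `T`, `v`
is a single column of `U` and need not be charged from every state. -/
theorem toReal_setLIntegral_tail {Q : Matrix X X ℝ} (hQ : IsSubintensity Q)
    {β : X → ℝ} (hβ : ∀ x, 0 ≤ β x) {v : X → ℝ} (hv : ∀ x, 0 ≤ v x) {n : ℕ} {θ y : ℝ}
    (hy : 0 ≤ y) (hunit : IsUnit (augMatrix n θ Q))
    (h : ∫⁻ t in Set.Ioi y, ENNReal.ofReal (t ^ n * Real.exp (-θ * t) *
      ((β ᵥ* NormedSpace.exp (t • Q)) ⬝ᵥ exitRates Q)) ≠ ⊤) :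
    (∫⁻ t in Set.Ioi y, ENNReal.ofReal (t ^ n * Real.exp (-θ * t) *
      ((β ᵥ* NormedSpace.exp (t • Q)) ⬝ᵥ v))).toReal =
      n.factorial * ((augInit n β ᵥ* (NormedSpace.exp (y • augMatrix n θ Q) *
        (-augMatrix n θ Q)⁻¹)) ⬝ᵥ augExit n v) := by
  have hcont := continuous_vecMul_exp_dotProduct β Q v
  rw [← integral_tail_eq hQ hβ hy hunit
    (integrableOn_tail_of_setLIntegral_ne_top hQ hβ (exitRates_nonneg hQ) hy h),
    integral_eq_lintegral_of_nonneg_ae]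
  · exact (ae_restrict_mem measurableSet_Ioi).mono fun t ht =>
      tail_nonneg hQ hβ hv (hy.trans (Set.mem_Ioi.1 ht).le)
  · exact Continuous.aestronglyMeasurable (by fun_prop)

theorem selLeft_mul_mulVec (n : ℕ) (M : Matrix (Fin (n + 1) × X) (Fin (n + 1) × X) ℝ)
    (u : Fin (n + 1) × X → ℝ) (k : X) :
    ((selLeft X n * M) *ᵥ u) k = (augInit n (Pi.single k 1) ᵥ* M) ⬝ᵥ u := by
  have hrow : selLeft X n k = augInit n (Pi.single k 1) := by
    ext a
    simp only [selLeft, augInit, Matrix.of_apply, Matrix.one_apply, Pi.single_apply, eq_comm]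
  rw [← Matrix.mulVec_mulVec, ← Matrix.dotProduct_mulVec, ← hrow]
  rfl

/-- The factors `e_kᵀ ⊗ e_kᵀ` pick out only the diagonal entries `b k * c k` of the Kronecker
product. -/
theorem vecMul_selDown_shockMatrix_dotProduct_kron {S : Type*} [Fintype S] [DecidableEq S]
    (n : ℕ) (v : Fin (n + 1) × X → ℝ) (U : Matrix X S ℝ) (b c : S → ℝ) :
    (v ᵥ* (selDown X n * shockMatrix U)) ⬝ᵥ kron b c =
      ∑ k, (v ⬝ᵥ augExit n fun j => U j k) * b k * c k := by
  have h1 : shockMatrix U *ᵥ kron b c = fun j => ∑ k, U j k * (b k * c k) := by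
    ext j
    rw [shockMatrix, Matrix.sum_mulVec, Finset.sum_apply]
    refine Finset.sum_congr rfl fun k _ => ?_
    have h2 : kron (Pi.single k 1) (Pi.single k 1) ⬝ᵥ kron b c = b k * c k := by
      simp only [dotProduct, kron, Fintype.sum_prod_type, Pi.single_apply]
      rw [Finset.sum_eq_single k, Finset.sum_eq_single k] <;> simp +contextual
    rw [Matrix.vecMulVec_mulVec, h2]
    simp
  have h3 : ∀ u : X → ℝ, selDown X n *ᵥ u = augExit n u := by
    intro u
    ext a
    simp only [Matrix.mulVec, dotProduct, selDown, augExit, Matrix.of_apply]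
    split_ifs <;> simp [Matrix.one_apply]
  rw [← Matrix.dotProduct_mulVec, ← Matrix.mulVec_mulVec, h1, h3]
  simp only [dotProduct, Finset.sum_mul]
  rw [Finset.sum_comm]
  refine Finset.sum_congr rfl fun a _ => ?_
  simp only [augExit]
  split_ifs
  · rw [Finset.mul_sum]
    exact Finset.sum_congr rfl fun k _ => by ring
  · simp

end Assembly

/-! ### Decomposition of the moment by the shock state -/

section Moments

variable {Ω E S : Type*} [MeasurableSpace Ω] [Fintype E] [DecidableEq E] [Fintype S]
  [DecidableEq S] {P : Measure Ω} [IsProbabilityMeasure P] {α : E → ℝ} {T : Matrix E E ℝ}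
  {U : Matrix E S ℝ} {Q₁ Q₂ : Matrix S S ℝ} {J₁₂ : ℝ≥0 → Ω → E ⊕ S}
  {J₁ J₂ : ℝ≥0 → Ω → E ⊕ (S ⊕ Unit)}

/-- The mixed moment, as a sum over the state entered at the shock. -/
theorem IsCommonShock.lintegral_tiltedTruncated (hJ : IsCommonShock α T U Q₁ Q₂ P J₁₂ J₁ J₂)
    (n₁₂ n₁ n₂ : ℕ) (θ₁₂ θ₁ θ₂ : ℝ) {y₁₂ y₁ y₂ : ℝ} (hy₁₂ : 0 ≤ y₁₂) (hy₁ : 0 ≤ y₁)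
    (hy₂ : 0 ≤ y₂) :
    ∫⁻ ω, ENNReal.ofReal (tiltedTruncated n₁₂ n₁ n₂ θ₁₂ θ₁ θ₂ y₁₂ y₁ y₂
      (shockTime J₁₂ ω) (residualTime J₁ ω) (residualTime J₂ ω)) ∂P =
      ∑ k,
        (∫⁻ t in Set.Ioi y₁₂, ENNReal.ofReal (t ^ n₁₂ * Real.exp (-θ₁₂ * t) *
          ((α ᵥ* NormedSpace.exp (t • T)) ⬝ᵥ fun j => U j k))) *
        (∫⁻ t in Set.Ioi y₁, ENNReal.ofReal (t ^ n₁ * Real.exp (-θ₁ * t) *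
          ((Pi.single k 1 ᵥ* NormedSpace.exp (t • Q₁)) ⬝ᵥ exitRates Q₁))) *
        (∫⁻ t in Set.Ioi y₂, ENNReal.ofReal (t ^ n₂ * Real.exp (-θ₂ * t) *
          ((Pi.single k 1 ᵥ* NormedSpace.exp (t • Q₂)) ⬝ᵥ exitRates Q₂))) := by
  have hsingle : ∀ k j : S, 0 ≤ (Pi.single k 1 : S → ℝ) j := fun k =>
    (Pi.single_nonneg.2 zero_le_one : (0 : S → ℝ) ≤ Pi.single k 1)
  have hmem : ∀ᵐ ω ∂P, ω ∈ ⋃ k : S, {ω | shockState J₁₂ ω = Sum.inr k} := by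
    filter_upwards [hJ.ae_exists_shockState] with ω h
    exact Set.mem_iUnion.2 h
  rw [← Measure.restrict_eq_self_of_ae_mem hmem,
    lintegral_iUnion₀ hJ.nullMeasurableSet_shockState, tsum_fintype]
  · refine Finset.sum_congr rfl fun k _ => ?_
    rw [← lintegral_mul_tiltedFactor hy₁₂ (fun t ht => dotProduct_nonneg_of_nonneg
        (vecMul_exp_smul_nonneg hJ.param.subintensity_T hJ.param.init_nonneg ht)
        (fun j => hJ.param.U_nonneg j k)),
      ← lintegral_mul_tiltedFactor hy₁ (fun t ht => dotProduct_nonneg_of_nonneg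
        (vecMul_exp_smul_nonneg hJ.param.subintensity_Q₁ (hsingle k) ht)
        (exitRates_nonneg hJ.param.subintensity_Q₁)),
      ← lintegral_mul_tiltedFactor hy₂ (fun t ht => dotProduct_nonneg_of_nonneg
        (vecMul_exp_smul_nonneg hJ.param.subintensity_Q₂ (hsingle k) ht)
        (exitRates_nonneg hJ.param.subintensity_Q₂)),
      ← hJ.setLIntegral_prod k (measurable_tiltedFactor n₁₂ θ₁₂ y₁₂).ennreal_ofReal
        (measurable_tiltedFactor n₁ θ₁ y₁).ennreal_ofReal
        (measurable_tiltedFactor n₂ θ₂ y₂).ennreal_ofReal]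
    refine lintegral_congr fun ω => ?_
    have h1 := tiltedFactor_nonneg (n := n₁₂) (θ := θ₁₂) (y := y₁₂) (shockTime J₁₂ ω).coe_nonneg
    have h2 : 0 ≤ tiltedFactor n₁ θ₁ y₁ (residualTime J₁ ω) :=
      tiltedFactor_nonneg ENNReal.toReal_nonneg
    rw [tiltedTruncated_eq, ENNReal.ofReal_mul (mul_nonneg h1 h2), ENNReal.ofReal_mul h1]
  · intro k l hkl
    refine Disjoint.aedisjoint (Set.disjoint_left.2 fun ω h1 h2 => hkl ?_)
    exact Sum.inr_injective (h1.symm.trans h2)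

theorem IsParam.exitRates_eq (h : IsParam α T U Q₁ Q₂) (e : E) : exitRates T e = ∑ k, U e k := by
  have := h.conservative e
  simp only [exitRates, Pi.neg_apply, Matrix.mulVec, dotProduct, mul_one]
  linarith

end Moments

end CommonShock

theorem mainTheorem5 {Ω E S : Type*} [MeasurableSpace Ω]
    [Fintype E] [DecidableEq E] [Fintype S] [DecidableEq S]
    (P : Measure Ω) [IsProbabilityMeasure P]
    (α : E → ℝ) (T : Matrix E E ℝ) (U : Matrix E S ℝ) (Q₁ Q₂ : Matrix S S ℝ)
    (J₁₂ : ℝ≥0 → Ω → E ⊕ S) (J₁ J₂ : ℝ≥0 → Ω → E ⊕ (S ⊕ Unit))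
    (hJ : CommonShock.IsCommonShock α T U Q₁ Q₂ P J₁₂ J₁ J₂)
    (n₁₂ n₁ n₂ : ℕ) (θ₁₂ θ₁ θ₂ : ℝ) (y₁₂ y₁ y₂ : ℝ)
    (hy₁₂ : 0 ≤ y₁₂) (hy₁ : 0 ≤ y₁) (hy₂ : 0 ≤ y₂)
    (hconv : Integrable (fun ω => CommonShock.tiltedTruncated n₁₂ n₁ n₂ θ₁₂ θ₁ θ₂ y₁₂ y₁ y₂
      (CommonShock.shockTime J₁₂ ω) (CommonShock.residualTime J₁ ω)
      (CommonShock.residualTime J₂ ω)) P)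
    (hT : IsUnit (CommonShock.augMatrix n₁₂ θ₁₂ T))
    (hQ₁ : IsUnit (CommonShock.augMatrix n₁ θ₁ Q₁))
    (hQ₂ : IsUnit (CommonShock.augMatrix n₂ θ₂ Q₂)) :
    ∫ ω, CommonShock.tiltedTruncated n₁₂ n₁ n₂ θ₁₂ θ₁ θ₂ y₁₂ y₁ y₂
      (CommonShock.shockTime J₁₂ ω) (CommonShock.residualTime J₁ ω)
      (CommonShock.residualTime J₂ ω) ∂P =
    ((n₁₂.factorial : ℝ) * (n₁.factorial : ℝ) * (n₂.factorial : ℝ)) *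
      ((CommonShock.augInit n₁₂ α ᵥ*
          (NormedSpace.exp (y₁₂ • CommonShock.augMatrix n₁₂ θ₁₂ T) *
            (-CommonShock.augMatrix n₁₂ θ₁₂ T)⁻¹ *
            CommonShock.selDown E n₁₂ * CommonShock.shockMatrix U)) ⬝ᵥ
        CommonShock.kron
          ((CommonShock.selLeft S n₁ * NormedSpace.exp (y₁ • CommonShock.augMatrix n₁ θ₁ Q₁) *
              (-CommonShock.augMatrix n₁ θ₁ Q₁)⁻¹) *ᵥ
            CommonShock.augExit n₁ (CommonShock.exitRates Q₁))
          ((CommonShock.selLeft S n₂ * NormedSpace.exp (y₂ • CommonShock.augMatrix n₂ θ₂ Q₂) *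
              (-CommonShock.augMatrix n₂ θ₂ Q₂)⁻¹) *ᵥ
            CommonShock.augExit n₂ (CommonShock.exitRates Q₂))) := by
  have hy := hJ.lintegral_tiltedTruncated n₁₂ n₁ n₂ θ₁₂ θ₁ θ₂ hy₁₂ hy₁ hy₂
  set a : S → ENNReal := fun k => ∫⁻ t in Set.Ioi y₁₂, ENNReal.ofReal
    (t ^ n₁₂ * Real.exp (-θ₁₂ * t) * ((α ᵥ* NormedSpace.exp (t • T)) ⬝ᵥ fun j => U j k)) with ha
  set b : S → ENNReal := fun k => ∫⁻ t in Set.Ioi y₁, ENNReal.ofReal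
    (t ^ n₁ * Real.exp (-θ₁ * t) *
      ((Pi.single k 1 ᵥ* NormedSpace.exp (t • Q₁)) ⬝ᵥ CommonShock.exitRates Q₁)) with hb
  set c : S → ENNReal := fun k => ∫⁻ t in Set.Ioi y₂, ENNReal.ofReal
    (t ^ n₂ * Real.exp (-θ₂ * t) *
      ((Pi.single k 1 ᵥ* NormedSpace.exp (t • Q₂)) ⬝ᵥ CommonShock.exitRates Q₂)) with hc
  have hp := hJ.param
  have hsingle : ∀ k j : S, 0 ≤ (Pi.single k 1 : S → ℝ) j := fun k =>
    (Pi.single_nonneg.2 zero_le_one : (0 : S → ℝ) ≤ Pi.single k 1)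
  have hb0 : ∀ k, b k ≠ 0 := fun k => hp.subintensity_Q₁.setLIntegral_exit_ne_zero k n₁ θ₁ hy₁
  have hc0 : ∀ k, c k ≠ 0 := fun k => hp.subintensity_Q₂.setLIntegral_exit_ne_zero k n₂ θ₂ hy₂
  have hnonneg : ∀ ω, 0 ≤ CommonShock.tiltedTruncated n₁₂ n₁ n₂ θ₁₂ θ₁ θ₂ y₁₂ y₁ y₂
      (CommonShock.shockTime J₁₂ ω) (CommonShock.residualTime J₁ ω)
      (CommonShock.residualTime J₂ ω) := fun ω => by
    rw [CommonShock.tiltedTruncated_eq]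
    exact mul_nonneg (mul_nonneg (CommonShock.tiltedFactor_nonneg (NNReal.coe_nonneg _))
      (CommonShock.tiltedFactor_nonneg ENNReal.toReal_nonneg))
      (CommonShock.tiltedFactor_nonneg ENNReal.toReal_nonneg)
  have hfin : ∀ k, a k * b k * c k ≠ ⊤ := by
    have h := (lintegral_ofReal_ne_top_iff_integrable hconv.aestronglyMeasurable
      (Eventually.of_forall hnonneg)).2 hconv
    rw [hy] at h
    exact fun k => (ENNReal.sum_ne_top.1 h) k (Finset.mem_univ k)
  -- An infinite `a k` times nonzero `b k` and `c k` would make the product infinite.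
  have ha_fin : ∀ k, a k ≠ ⊤ := fun k hk => hfin k (by
    rw [hk, ENNReal.top_mul (hb0 k), ENNReal.top_mul (hc0 k)])
  -- The exit rates of `T` are the row sums of `U`, so finiteness of all `a k` is exactly finiteness
  -- against the exit rates.
  have hsum : ∫⁻ t in Set.Ioi y₁₂, ENNReal.ofReal (t ^ n₁₂ * Real.exp (-θ₁₂ * t) *
      ((α ᵥ* NormedSpace.exp (t • T)) ⬝ᵥ CommonShock.exitRates T)) = ∑ k, a k := by
    rw [ha, ← lintegral_finsetSum]
    · refine setLIntegral_congr_fun measurableSet_Ioi fun t ht => ?_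
      rw [← ENNReal.ofReal_sum_of_nonneg fun k _ => CommonShock.tail_nonneg hp.subintensity_T
        hp.init_nonneg (fun j => hp.U_nonneg j k) (hy₁₂.trans (Set.mem_Ioi.1 ht).le),
        ← Finset.mul_sum]
      congr 2
      simp only [dotProduct, hp.exitRates_eq, Finset.mul_sum]
      exact Finset.sum_comm
    · intro k _
      have := CommonShock.continuous_vecMul_exp_dotProduct α T fun j => U j k
      fun_prop
  have hT_fin : ∫⁻ t in Set.Ioi y₁₂, ENNReal.ofReal (t ^ n₁₂ * Real.exp (-θ₁₂ * t) *
      ((α ᵥ* NormedSpace.exp (t • T)) ⬝ᵥ CommonShock.exitRates T)) ≠ ⊤ := by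
    rw [hsum]
    exact ENNReal.sum_ne_top.2 fun k _ => ha_fin k
  have ha_eq : ∀ k, (a k).toReal = _ := fun k => CommonShock.toReal_setLIntegral_tail
    hp.subintensity_T hp.init_nonneg (v := fun j => U j k) (fun j => hp.U_nonneg j k) hy₁₂ hT hT_fin
  have hb_eq : ∀ k, b k ≠ ⊤ → (b k).toReal = _ := fun k h =>
    CommonShock.toReal_setLIntegral_tail hp.subintensity_Q₁ (hsingle k)
      (CommonShock.exitRates_nonneg hp.subintensity_Q₁) hy₁ hQ₁ h
  have hc_eq : ∀ k, c k ≠ ⊤ → (c k).toReal = _ := fun k h =>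
    CommonShock.toReal_setLIntegral_tail hp.subintensity_Q₂ (hsingle k)
      (CommonShock.exitRates_nonneg hp.subintensity_Q₂) hy₂ hQ₂ h
  rw [integral_eq_lintegral_of_nonneg_ae (Eventually.of_forall hnonneg)
    hconv.aestronglyMeasurable, hy, ENNReal.toReal_sum fun k _ => hfin k,
    Matrix.mul_assoc _ (CommonShock.selDown E n₁₂), ← Matrix.vecMul_vecMul,
    CommonShock.vecMul_selDown_shockMatrix_dotProduct_kron, Finset.mul_sum]
  refine Finset.sum_congr rfl fun k _ => ?_
  rw [Matrix.mul_assoc (CommonShock.selLeft S n₁), Matrix.mul_assoc (CommonShock.selLeft S n₂),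
    CommonShock.selLeft_mul_mulVec, CommonShock.selLeft_mul_mulVec, ENNReal.toReal_mul,
    ENNReal.toReal_mul]
  -- If `a k = 0`, then `b k` or `c k` may be infinite and their matrix formulas unavailable, but
  -- the matrix expression for `a k` is zero too, so both terms vanish.
  by_cases hak : a k = 0
  · have h0 := ha_eq k
    rw [hak, ENNReal.toReal_zero, eq_comm, mul_eq_zero] at h0
    rw [h0.resolve_left (by positivity), hak]
    simp
  · have hbk : b k ≠ ⊤ := fun h => hfin k (by
      rw [h, ENNReal.mul_top hak, ENNReal.top_mul (hc0 k)])
    have hck : c k ≠ ⊤ := fun h => hfin k (by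
      rw [h, ENNReal.mul_top (mul_ne_zero hak (hb0 k))])
    rw [ha_eq k, hb_eq k hbk, hc_eq k hck]
    ring
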